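/- Let $\Theta\subset\mathbb{R}^3$ be a bounded domain, $\mathbb{H}:=L^2(\Theta)^3\times L^2(\Theta)^3$, and let $M(\mathbf{E},\mathbf{H})=(\nabla\times\mathbf{H},-\nabla\times\mathbf{E})$ be the Maxwell operator on $\mathbb{H}$ with domain $\mathcal{D}(M)=H_0(\mathrm{curl},\Theta)\times H(\mathrm{curl},\Theta)$. Let $Q$ be a bounded symmetric positive definite operator on $L^2(\Theta)$, $U_0:=Q^{1/2}(L^2(\Theta))$, $\{e_j\}$ an orthonormal basis of $L^2(\Theta)$, and $W(t)=\sum_j\beta_j(t)Q^{1/2}e_j$ with $\{\beta_j\}$ independent real Brownian motions with respect to a filtered probability space $(\Omega,\mathcal{F},\{\mathcal{F}_t\}_{t\ge 0},\mathbb{P})$ (adapted, with the increments after time $s$ independent of $\mathcal{F}_s$). Let $F:\mathbb{H}\to\mathbb{H}$, $F(h)(\mathbf{x})=\big(-\mathbf{J}_e(\mathbf{x},h(\mathbf{x})),-\mathbf{J}_m(\mathbf{x},h(\mathbf{x}))\big)$, be the Nemytskij operator of Carathéodory functions $\mathbf{J}_e,\mathbf{J}_m$ (measurable in $\mathbf{x}$,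 continuous in the fields), and let $B:\mathbb{H}\to HS(U_0;\mathbb{H})$, $(B(h)v)(\mathbf{x})=\big(-\mathbf{J}^r_e(\mathbf{x},h(\mathbf{x}))v(\mathbf{x}),-\mathbf{J}^r_m(\mathbf{x},h(\mathbf{x}))v(\mathbf{x})\big)$. Assume that there are real constants $\alpha_{F,0},\alpha_{B,0}$ such that for all $u,v\in\mathbb{H}$ $$\langle u-v,F(u)-F(v)\rangle_{\mathbb{H}}\le\alpha_{F,0}\|u-v\|_{\mathbb{H}}^2,\qquad \|B(u)-B(v)\|_{HS(U_0;\mathbb{H})}\le\alpha_{B,0}\|u-v\|_{\mathbb{H}},$$ and put $\widetilde\alpha_{F,0}:=\tfrac12\max\{1+2\alpha_{F,0},\|F(0)\|_{\mathbb{H}}^2\}$ and $\widetilde\alpha_{B,0}:=\max\{\alpha_{B,0},\|B(0)\|_{HS(U_0;\mathbb{H})}\}$. For $\Delta t>0$ and $t_k:=k\Delta t$ consider the semi-implicit Euler scheme $$u_{k+1}-u_k=\Delta t\,Mu_{k+1}-\sigma_0\Delta t\,u_{k+1}+\Delta t\,F(u_{k+1})+B(u_k)\big(W(t_{k+1})-W(t_k)\big),\qquad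 k\in\mathbb{N},$$ where $B(u_k)(W(t_{k+1})-W(t_k))$ is the limit in probability of $\sum_{j\le n}(\beta_j(t_{k+1})-\beta_j(t_k))B(u_k)Q^{1/2}e_j$ as $n\to\infty$; a numerical solution is an $\mathbb{H}$-valued $\{\mathcal{F}_{t_k}\}$-adapted sequence $\{u_k\}_{k\in\mathbb{N}}$ that satisfies the scheme almost surely, with $u_{k+1}\in\mathcal{D}(M)$. Suppose $\sigma_0>\widetilde\alpha_{F,0}+2\widetilde\alpha_{B,0}^2$. Then there is $\delta>0$ such that for every $\Delta t\in(0,\delta)$: for every $\mathcal{F}_0$-measurable $u_0\in L^2(\Omega;\mathbb{H})$ the scheme has a numerical solution with initial value $u_0$, with $u_k\in L^2(\Omega;\mathbb{H})$ for all $k$, and it is unique up to almost sure equality; all numerical solutions are Markov chains with one and the same transition kernel $\kappa$ on $\mathbb{H}$, that is, $\mathbb{P}(u_{k+1}\in A\mid\mathcal{F}_{t_k})=\kappa(u_k,A)$ almost surely for all $k$ and all Borel sets $A\subset\mathbb{H}$; and there is exactly one invariant probability measure $\pi^{\Delta t}$ on $\mathbb{H}$, i.e. exactly one Borel probability measure with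 $\int_{\mathbb{H}}\kappa(x,A)\,\pi^{\Delta t}(\mathrm{d}x)=\pi^{\Delta t}(A)$ for all Borel sets $A\subset\mathbb{H}$. -/

import Mathlib

open MeasureTheory ProbabilityTheory Filter
open scoped NNReal

noncomputable section

namespace StochMaxwell

/-- Physical space `ℝ³` with its Euclidean structure. -/
abbrev R3 : Type := EuclideanSpace ℝ (Fin 3)

/-- The scalar space `L²(Θ)`. -/
abbrev L2Scalar (Θ : Set R3) : Type := Lp ℝ 2 (volume.restrict Θ)

/-- The space `L²(Θ)³` of square integrable vector fields. -/
abbrev L2Vec (Θ : Set R3) : Type := Lp R3 2 (volume.restrict Θ)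

/-- The real Hilbert space `ℍ = L²(Θ)³ × L²(Θ)³` with the inner product
`⟨(E, H), (E', H')⟩ = ⟨E, E'⟩ + ⟨H, H'⟩`; `u.fst` is the electric field, `u.snd` the magnetic one. -/
abbrev EMSpace (Θ : Set R3) : Type := WithLp 2 (L2Vec Θ × L2Vec Θ)

/-- `ℍ` carries its Borel sigma-algebra. -/
instance (Θ : Set R3) : MeasurableSpace (EMSpace Θ) := borel _

instance (Θ : Set R3) : BorelSpace (EMSpace Θ) := ⟨rfl⟩

/-! ### The Maxwell operator -/

/-- The partial derivative `∂ᵢ φⱼ` at `x`. -/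
def partialD (φ : R3 → R3) (i j : Fin 3) (x : R3) : ℝ :=
  (fderiv ℝ φ x (EuclideanSpace.single i 1)) j

/-- The classical curl `∇ × φ`. -/
def curl (φ : R3 → R3) (x : R3) : R3 :=
  !₂[partialD φ 1 2 x - partialD φ 2 1 x,
     partialD φ 2 0 x - partialD φ 0 2 x,
     partialD φ 0 1 x - partialD φ 1 0 x]

/-- `v ∈ H(curl, Θ)` with distributional curl `c = ∇ × v ∈ L²(Θ)³`. -/
def IsWeakCurl (Θ : Set R3) (v c : L2Vec Θ) : Prop :=
  ∀ φ : R3 → R3, ContDiff ℝ (⊤ : ℕ∞) φ → HasCompactSupport φ → tsupport φ ⊆ Θ →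
    ∫ x in Θ, inner ℝ (c x) (φ x) = ∫ x in Θ, inner ℝ (v x) (curl φ x)

/-- `v ∈ H₀(curl, Θ)` with `c = ∇ × v`: the field `v` lies in `H(curl, Θ)` and its tangential
trace `n × v` on `∂Θ` vanishes, which means that the boundary term
`∫_Θ (∇ × v) · w - ∫_Θ v · (∇ × w)` of Green's formula is zero for all `w ∈ H(curl, Θ)`. -/
def IsWeakCurlZeroTrace (Θ : Set R3) (v c : L2Vec Θ) : Prop :=
  IsWeakCurl Θ v c ∧ ∀ w d : L2Vec Θ, IsWeakCurl Θ w d → inner ℝ c w = inner ℝ v d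

/-- The graph of the Maxwell operator: `u = (E, H)` lies in
`D(M) = H₀(curl, Θ) × H(curl, Θ)`, and `z = M u = (∇ × H, - ∇ × E)`. -/
def IsMaxwell (Θ : Set R3) (u z : EMSpace Θ) : Prop :=
  IsWeakCurl Θ u.snd z.fst ∧ IsWeakCurlZeroTrace Θ u.fst (-z.snd)

/-! ### Nemytskij operators -/

/-- A Caratheodory function on `Θ × ℝ³ × ℝ³`: measurable in the space variable, continuous in the
field variables for almost every point of `Θ`. -/
def IsCaratheodory (Θ : Set R3) (J : R3 → R3 → R3 → R3) : Prop :=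
  (∀ a b : R3, AEStronglyMeasurable (fun x => J x a b) (volume.restrict Θ)) ∧
    ∀ᵐ x ∂(volume.restrict Θ), Continuous fun p : R3 × R3 => J x p.1 p.2

/-- `F : ℍ → ℍ` is the Nemytskij operator
`F(h)(x) = (-Jₑ(x, h₁(x), h₂(x)), -Jₘ(x, h₁(x), h₂(x)))`. -/
def IsDriftNemytskij (Θ : Set R3) (Je Jm : R3 → R3 → R3 → R3) (F : EMSpace Θ → EMSpace Θ) :
    Prop :=
  ∀ h : EMSpace Θ,
    ((F h).fst =ᵐ[volume.restrict Θ] fun x => -Je x (h.fst x) (h.snd x)) ∧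
    ((F h).snd =ᵐ[volume.restrict Θ] fun x => -Jm x (h.fst x) (h.snd x))

/-- The space `U₀ = Q^{1/2}(L²(Θ))`. -/
abbrev U0 {Θ : Set R3} (sqrtQ : L2Scalar Θ →L[ℝ] L2Scalar Θ) : Submodule ℝ (L2Scalar Θ) :=
  LinearMap.range (sqrtQ : L2Scalar Θ →ₗ[ℝ] L2Scalar Θ)

/-- The element `Q^{1/2} v` of `U₀`. -/
def toU0 {Θ : Set R3} (sqrtQ : L2Scalar Θ →L[ℝ] L2Scalar Θ) (v : L2Scalar Θ) : U0 sqrtQ :=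
  ⟨sqrtQ v, LinearMap.mem_range_self _ v⟩

/-- `B(h)` is the multiplication operator
`(B(h)v)(x) = (-Jₑʳ(x, h₁(x), h₂(x)) v(x), -Jₘʳ(x, h₁(x), h₂(x)) v(x))` on `U₀`. -/
def IsDiffusionNemytskij (Θ : Set R3) (sqrtQ : L2Scalar Θ →L[ℝ] L2Scalar Θ)
    (Jer Jmr : R3 → R3 → R3 → R3) (B : EMSpace Θ → (U0 sqrtQ →ₗ[ℝ] EMSpace Θ)) : Prop :=
  ∀ (h : EMSpace Θ) (v : U0 sqrtQ),
    ((B h v).fst =ᵐ[volume.restrict Θ]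
      fun x => -((v : L2Scalar Θ) x • Jer x (h.fst x) (h.snd x))) ∧
    ((B h v).snd =ᵐ[volume.restrict Θ]
      fun x => -((v : L2Scalar Θ) x • Jmr x (h.fst x) (h.snd x)))

/-! ### Hilbert-Schmidt operators on `U₀`

For injective `Q^{1/2}` the inner product of `U₀` makes `Q^{1/2} : L²(Θ) → U₀` an isometry onto, so
`‖Q^{1/2} v‖_{U₀} = ‖v‖`, and `(Q^{1/2} eⱼ)ⱼ` is an orthonormal basis of `U₀` for every orthonormal
basis `(eⱼ)ⱼ` of `L²(Θ)`. -/

/-- `Γ` is a Hilbert-Schmidt operator from `U₀` to `ℍ`. -/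
def IsHS {Θ : Set R3} {sqrtQ : L2Scalar Θ →L[ℝ] L2Scalar Θ}
    (e : HilbertBasis ℕ ℝ (L2Scalar Θ)) (Γ : U0 sqrtQ →ₗ[ℝ] EMSpace Θ) : Prop :=
  (∃ C : ℝ, ∀ v : L2Scalar Θ, ‖Γ (toU0 sqrtQ v)‖ ≤ C * ‖v‖) ∧
    Summable fun j => ‖Γ (toU0 sqrtQ (e j))‖ ^ 2

/-- The norm of `HS(U₀; ℍ)`. -/
def hsNorm {Θ : Set R3} {sqrtQ : L2Scalar Θ →L[ℝ] L2Scalar Θ}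
    (e : HilbertBasis ℕ ℝ (L2Scalar Θ)) (Γ : U0 sqrtQ →ₗ[ℝ] EMSpace Θ) : ℝ :=
  Real.sqrt (∑' j, ‖Γ (toU0 sqrtQ (e j))‖ ^ 2)

/-! ### The covariance operator and the driving noise -/

/-- `Q` is a symmetric, positive definite operator on `L²(Θ)`, and `sqrtQ` is its (unique)
positive square root `Q^{1/2}`. -/
structure IsCovarianceWithSqrt {Θ : Set R3} (Q sqrtQ : L2Scalar Θ →L[ℝ] L2Scalar Θ) : Prop where
  symm : ∀ v w : L2Scalar Θ, inner ℝ (Q v) w = inner ℝ v (Q w)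
  posDef : ∀ v : L2Scalar Θ, v ≠ 0 → 0 < inner ℝ (Q v) v
  sqrt_pos : sqrtQ.IsPositive
  sqrt_sq : sqrtQ ∘L sqrtQ = Q

/-- `β₀, β₁, …` are independent real Brownian motions with respect to the filtration `𝓕`: they are
adapted, and for `s ≤ t` the increments `(βⱼ(t) - βⱼ(s))ⱼ` are independent of `𝓕 s`. They are the
coordinates of the `Q`-Wiener process `W(t) = ∑ⱼ βⱼ(t) Q^{1/2} eⱼ`. -/
structure IsBrownianFamily {Ω : Type*} {mΩ : MeasurableSpace Ω} (P : Measure Ω)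
    (𝓕 : Filtration ℝ≥0 mΩ) (β : ℕ → ℝ≥0 → Ω → ℝ) : Prop where
  brownian : ∀ j, IsBrownianReal (β j) P
  indep : iIndepFun (fun j ω t => β j t ω) P
  adapted : ∀ j t, StronglyMeasurable[𝓕 t] (β j t)
  indep_past : ∀ s t : ℝ≥0, s ≤ t →
    Indep (MeasurableSpace.comap (fun ω j => β j t ω - β j s ω) inferInstance) (𝓕 s) P

/-- The random variable `Z` is `B(w) (W(t) - W(s))` for the random element `w` of `ℍ`, i.e. the
limit in probability of `B(w) (∑_{j<n} (βⱼ(t) - βⱼ(s)) Q^{1/2} eⱼ)` as `n → ∞`. -/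
def IsNoiseIncrement {Θ : Set R3} {Ω : Type*} {mΩ : MeasurableSpace Ω} (P : Measure Ω)
    (β : ℕ → ℝ≥0 → Ω → ℝ) (e : HilbertBasis ℕ ℝ (L2Scalar Θ))
    {sqrtQ : L2Scalar Θ →L[ℝ] L2Scalar Θ} (B : EMSpace Θ → (U0 sqrtQ →ₗ[ℝ] EMSpace Θ))
    (s t : ℝ≥0) (w Z : Ω → EMSpace Θ) : Prop :=
  TendstoInMeasure P
    (fun (n : ℕ) ω => B (w ω)
      (∑ j ∈ Finset.range n, (β j t ω - β j s ω) • toU0 sqrtQ (e j)))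
    atTop Z

/-! ### The semi-implicit Euler scheme -/

/-- `(u_k)` is a numerical solution with step size `Δt` (grid points `t_k = k Δt`): it is
`(𝓕 (t_k))`-adapted, and almost surely `u_{k+1} ∈ D(M)` and
`u_{k+1} - u_k = Δt M u_{k+1} - σ₀ Δt u_{k+1} + Δt F(u_{k+1}) + B(u_k) (W(t_{k+1}) - W(t_k))`. -/
structure IsNumericalSolution {Θ : Set R3} {Ω : Type*} {mΩ : MeasurableSpace Ω} (P : Measure Ω)
    (𝓕 : Filtration ℝ≥0 mΩ) (β : ℕ → ℝ≥0 → Ω → ℝ) (e : HilbertBasis ℕ ℝ (L2Scalar Θ))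
    {sqrtQ : L2Scalar Θ →L[ℝ] L2Scalar Θ} (σ₀ : ℝ) (F : EMSpace Θ → EMSpace Θ)
    (B : EMSpace Θ → (U0 sqrtQ →ₗ[ℝ] EMSpace Θ)) (Δt : ℝ≥0) (u : ℕ → Ω → EMSpace Θ) : Prop where
  adapted : ∀ k : ℕ, StronglyMeasurable[𝓕 (k * Δt)] (u k)
  scheme : ∀ k : ℕ, ∃ Z : Ω → EMSpace Θ,
    IsNoiseIncrement P β e B (k * Δt) ((k + 1 : ℕ) * Δt) (u k) Z ∧
    ∀ᵐ ω ∂P, ∃ z : EMSpace Θ, IsMaxwell Θ (u (k + 1) ω) z ∧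
      u (k + 1) ω - u k ω =
        (Δt : ℝ) • z - (σ₀ * Δt) • u (k + 1) ω + (Δt : ℝ) • F (u (k + 1) ω) + Z ω

/-- `κ` is the one-step transition kernel of the scheme: every numerical solution is a Markov chain
with respect to `(𝓕 (t_k))` with transition probabilities `ℙ(u_{k+1} ∈ A | 𝓕 (t_k)) = κ(u_k, A)`.
In particular `κ(x, ·)` is the law of `u₁` for the numerical solution with `u₀ = x`. -/
def IsTransitionKernel {Θ : Set R3} {Ω : Type*} {mΩ : MeasurableSpace Ω} (P : Measure Ω)
    (𝓕 : Filtration ℝ≥0 mΩ) (β : ℕ → ℝ≥0 → Ω → ℝ) (e : HilbertBasis ℕ ℝ (L2Scalar Θ))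
    {sqrtQ : L2Scalar Θ →L[ℝ] L2Scalar Θ} (σ₀ : ℝ) (F : EMSpace Θ → EMSpace Θ)
    (B : EMSpace Θ → (U0 sqrtQ →ₗ[ℝ] EMSpace Θ)) (Δt : ℝ≥0)
    (κ : Kernel (EMSpace Θ) (EMSpace Θ)) : Prop :=
  ∀ u : ℕ → Ω → EMSpace Θ, IsNumericalSolution P 𝓕 β e σ₀ F B Δt u →
    ∀ (k : ℕ) (A : Set (EMSpace Θ)), MeasurableSet A →
      P[Set.indicator (u (k + 1) ⁻¹' A) (fun _ => (1 : ℝ)) | 𝓕 (k * Δt)]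
        =ᵐ[P] fun ω => (κ (u k ω)).real A

/-! ### The constants of the linear growth bounds -/

/-- `α̃_{F,0} = ½ max {1 + 2 α_{F,0}, ‖F(0)‖²}`. -/
def alphaTildeF {Θ : Set R3} (F : EMSpace Θ → EMSpace Θ) (αF : ℝ) : ℝ :=
  (1 / 2) * max (1 + 2 * αF) (‖F 0‖ ^ 2)

/-- `α̃_{B,0} = max {α_{B,0}, ‖B(0)‖_{HS(U₀;ℍ)}}`. -/
def alphaTildeB {Θ : Set R3} {sqrtQ : L2Scalar Θ →L[ℝ] L2Scalar Θ}
    (e : HilbertBasis ℕ ℝ (L2Scalar Θ)) (B : EMSpace Θ → (U0 sqrtQ →ₗ[ℝ] EMSpace Θ))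
    (αB : ℝ) : ℝ :=
  max αB (hsNorm e (B 0))

end StochMaxwell

end

open StochMaxwell

open StochMaxwell
open scoped Topology

/-! One step of the scheme is `S (u + B(u)ΔW)`, where `S` solves the implicit equation. The Maxwell
operator is skew, so it disappears when the difference of two implicit equations is paired with the
difference of the solutions; the one-sided Lipschitz bound on `F` then makes `S` Lipschitz with
constant `(1 + τa)⁻¹`, `a = σ₀ - αF` (`mul_norm_sub_le_of_implicit_step`). The noise is centred and
independent of the past, so by the Itô isometry one step contracts in mean square with factor `(1 +
τα²)^{1/2} / (1 + τa)`, where `α` is the constant `α̃_{B,0}`. This is below `1` because `a > 2α²`.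

Everything probabilistic follows from this contraction. Feeding the step with an i.i.d. sequence
gives a contraction on the square integrable functions of that sequence, and the law of its fixed
point is invariant (`exists_invariant_randomMapKernel`). The transition operator shrinks Lipschitz
constants by the same factor, so two invariant laws integrate bounded Lipschitz functions equally
(`invariant_randomMapKernel_unique`).

The analytic work is the existence of `S` (`exists_mem_sub_eq_of_skew`): `F` is only one-sided
Lipschitz, and the only continuity used is weak continuity along lines, which comes from the
Carathéodory property (`IsDriftNemytskij.tendsto_inner_line`). A finite minimax argument and weak
compactness give a point `x` satisfying the monotone variational inequality. Yosida approximation,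
with local boundedness of monotone maps, puts `x` in the domain of the skew operator, and Minty's
trick turns the inequality into the equation. Maximality of the Maxwell operator is von Neumann's
orthogonal decomposition by graphs (`exists_mem_maxwellGraph_sub_smul_eq`). -/

/-! ### Monotone families and monotone maps in a Hilbert space -/

theorem sum_sum_mul_inner_sub_sub {H ι : Type*} [NormedAddCommGroup H] [InnerProductSpace ℝ H]
    [Fintype ι] (x y : ι → H) (w : ι → ℝ) (hw : ∑ i, w i = 1) :
    ∑ i, ∑ j, w i * w j * inner ℝ (x i - x j) (y i - y j) =
      2 * (∑ i, w i * inner ℝ (x i) (y i) - inner ℝ (∑ i, w i • x i) (∑ i, w i • y i)) := by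
  have h1 : inner ℝ (∑ i, w i • x i) (∑ i, w i • y i) =
      ∑ i, ∑ j, w i * w j * inner ℝ (x i) (y j) := by
    rw [sum_inner]
    refine Finset.sum_congr rfl fun i _ => ?_
    rw [inner_sum]
    refine Finset.sum_congr rfl fun j _ => ?_
    rw [real_inner_smul_left, real_inner_smul_right]; ring
  have h2 : ∑ i, ∑ j, w i * w j * inner ℝ (x j) (y i) =
      ∑ i, ∑ j, w i * w j * inner ℝ (x i) (y j) := by
    rw [Finset.sum_comm]
    exact Finset.sum_congr rfl fun i _ => Finset.sum_congr rfl fun j _ => by ring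
  have h3 : ∑ i, ∑ j, w i * w j * inner ℝ (x i) (y i) = ∑ i, w i * inner ℝ (x i) (y i) := by
    refine Finset.sum_congr rfl fun i _ => ?_
    rw [← Finset.sum_mul, ← Finset.mul_sum, hw, mul_one]
  have h4 : ∑ i, ∑ j, w i * w j * inner ℝ (x j) (y j) = ∑ i, w i * inner ℝ (x i) (y i) := by
    rw [Finset.sum_comm, ← h3]
    exact Finset.sum_congr rfl fun i _ => Finset.sum_congr rfl fun j _ => by ring
  have h5 : ∀ i j, w i * w j * inner ℝ (x i - x j) (y i - y j) =
      w i * w j * inner ℝ (x i) (y i) + w i * w j * inner ℝ (x j) (y j)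
        - w i * w j * inner ℝ (x j) (y i) - w i * w j * inner ℝ (x i) (y j) := by
    intro i j
    rw [inner_sub_left, inner_sub_right, inner_sub_right]; ring
  simp_rw [h5, Finset.sum_sub_distrib, Finset.sum_add_distrib]
  rw [h3, h4, h2, h1]; ring

/-- A finite strongly monotone family in a Hilbert space can be extended by the value `0` at some
point. -/
theorem exists_forall_mul_norm_sub_sq_le_inner {H ι : Type*} [NormedAddCommGroup H]
    [InnerProductSpace ℝ H] [Fintype ι] (v T : ι → H) {c : ℝ} (hc : 0 < c)
    (h : ∀ i j, c * ‖v i - v j‖ ^ 2 ≤ inner ℝ (T i - T j) (v i - v j)) :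
    ∃ u : H, ∀ i, c * ‖v i - u‖ ^ 2 ≤ inner ℝ (T i) (v i - u) := by
  classical
  rcases isEmpty_or_nonempty ι with hι | ⟨⟨i₀⟩⟩
  · exact ⟨0, fun i => (hι.false i).elim⟩
  -- The required inequality reads `a i + ⟨b i, u⟩ + c‖u‖² ≤ 0`. Averaged with weights `w`, its left
  -- side has minimum `D w` over `u`, attained at `u = -bw / (2c)`. Hence maximise the dual function
  -- `D` over the simplex and take the corresponding `u`.
  set b : ι → H := fun i => T i - (2 * c) • v i with hb
  set a : ι → ℝ := fun i => c * ‖v i‖ ^ 2 - inner ℝ (T i) (v i) with ha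
  set D : (ι → ℝ) → ℝ := fun w => ∑ i, w i * a i - ‖∑ i, w i • b i‖ ^ 2 / (4 * c) with hD
  have hDc : Continuous D := by simp only [hD]; fun_prop
  obtain ⟨w, hw, hmax⟩ := (isCompact_stdSimplex ℝ ι).exists_isMaxOn
    ⟨_, single_mem_stdSimplex ℝ i₀⟩ hDc.continuousOn
  have hw1 : ∑ i, w i = 1 := hw.2
  set bw := ∑ i, w i • b i with hbw
  set aw := ∑ i, w i * a i with haw
  -- the maximal value is nonpositive
  have hneg : D w ≤ 0 := by
    -- Averaging strong monotonicity over all pairs shows that `D w` is at most `-‖Tw‖² / (4c)`.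
    have h1 : 0 ≤ ∑ i, ∑ j, w i * w j *
        (inner ℝ (T i - T j) (v i - v j) - c * inner ℝ (v i - v j) (v i - v j)) := by
      refine Finset.sum_nonneg fun i _ => Finset.sum_nonneg fun j _ => ?_
      refine mul_nonneg (mul_nonneg (hw.1 i) (hw.1 j)) ?_
      rw [real_inner_self_eq_norm_sq]; linarith [h i j]
    have h2 : ∑ i, ∑ j, w i * w j *
        (inner ℝ (T i - T j) (v i - v j) - c * inner ℝ (v i - v j) (v i - v j)) =
        ∑ i, ∑ j, w i * w j * inner ℝ (T i - T j) (v i - v j) -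
          c * ∑ i, ∑ j, w i * w j * inner ℝ (v i - v j) (v i - v j) := by
      rw [Finset.mul_sum, ← Finset.sum_sub_distrib]
      refine Finset.sum_congr rfl fun i _ => ?_
      rw [Finset.mul_sum, ← Finset.sum_sub_distrib]
      exact Finset.sum_congr rfl fun j _ => by ring
    rw [h2, sum_sum_mul_inner_sub_sub _ _ _ hw1, sum_sum_mul_inner_sub_sub _ _ _ hw1] at h1
    set Tw := ∑ i, w i • T i with hTw
    set vw := ∑ i, w i • v i with hvw
    have h3 : bw = Tw - (2 * c) • vw := by
      simp only [hbw, hb, hTw, hvw, smul_sub, Finset.sum_sub_distrib, Finset.smul_sum]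
      congr 1
      exact Finset.sum_congr rfl fun i _ => smul_comm _ _ _
    have h4 : aw = c * ∑ i, w i * inner ℝ (v i) (v i) - ∑ i, w i * inner ℝ (T i) (v i) := by
      simp only [haw, ha, mul_sub, Finset.sum_sub_distrib, Finset.mul_sum,
        real_inner_self_eq_norm_sq]
      congr 1
      exact Finset.sum_congr rfl fun i _ => by ring
    have h5 : ‖bw‖ ^ 2 = ‖Tw‖ ^ 2 - 4 * c * inner ℝ Tw vw + 4 * c ^ 2 * inner ℝ vw vw := by
      rw [h3, norm_sub_sq_real, real_inner_smul_right, norm_smul, real_inner_self_eq_norm_sq,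
        mul_pow, Real.norm_eq_abs, sq_abs]; ring
    have h6 : D w = aw - ‖bw‖ ^ 2 / (4 * c) := rfl
    have h7 : ‖bw‖ ^ 2 / (4 * c) = ‖Tw‖ ^ 2 / (4 * c) - inner ℝ Tw vw + c * inner ℝ vw vw := by
      rw [h5]; field_simp
    have h8 : 0 ≤ ‖Tw‖ ^ 2 / (4 * c) := by positivity
    rw [h6, h7, h4]; linarith
  -- optimality
  refine ⟨-((1 / (2 * c)) • bw), fun i => ?_⟩
  -- The derivative of `D` at the maximiser towards the vertex `i` is nonpositive: the remainder is
  -- quadratic in `t`, so divide by `t` and let `t → 0`.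
  have hopt : a i - aw - inner ℝ bw (b i - bw) / (2 * c) ≤ 0 := by
    have key : ∀ t : ℝ, 0 < t → t ≤ 1 →
        a i - aw - inner ℝ bw (b i - bw) / (2 * c) ≤ t * (‖b i - bw‖ ^ 2 / (4 * c)) := by
      intro t ht0 ht1
      have hmem : (1 - t) • w + t • (Pi.single i 1 : ι → ℝ) ∈ stdSimplex ℝ ι :=
        convex_stdSimplex ℝ ι hw (single_mem_stdSimplex ℝ i) (by linarith) ht0.le (by ring)
      have hle : D ((1 - t) • w + t • (Pi.single i 1 : ι → ℝ)) ≤ D w := hmax hmem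
      have e1 : ∑ j, ((1 - t) • w + t • (Pi.single i 1 : ι → ℝ)) j * a j
          = (1 - t) * aw + t * a i := by
        simp [add_mul, Finset.sum_add_distrib, haw, Finset.mul_sum, Pi.single_apply, mul_assoc]
      have e2 : ∑ j, ((1 - t) • w + t • (Pi.single i 1 : ι → ℝ)) j • b j
          = bw + t • (b i - bw) := by
        simp only [Pi.add_apply, Pi.smul_apply, smul_eq_mul, add_smul, Finset.sum_add_distrib,
          mul_smul, ← Finset.smul_sum, Pi.single_apply, ite_smul, one_smul, zero_smul,
          Finset.sum_ite_eq', Finset.mem_univ, if_true]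
        simp only [sub_smul, one_smul, smul_sub, ← hbw]
        abel
      have e3 : ‖bw + t • (b i - bw)‖ ^ 2 =
          ‖bw‖ ^ 2 + 2 * t * inner ℝ bw (b i - bw) + t ^ 2 * ‖b i - bw‖ ^ 2 := by
        rw [norm_add_sq_real, real_inner_smul_right, norm_smul, mul_pow, Real.norm_eq_abs, sq_abs]
        ring
      have e4 : D ((1 - t) • w + t • (Pi.single i 1 : ι → ℝ)) =
          (1 - t) * aw + t * a i -
          (‖bw‖ ^ 2 + 2 * t * inner ℝ bw (b i - bw) + t ^ 2 * ‖b i - bw‖ ^ 2) / (4 * c) := by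
        simp only [hD]; rw [e1, e2, e3]
      have e5 : D w = aw - ‖bw‖ ^ 2 / (4 * c) := rfl
      rw [e4, e5] at hle
      have e6 : (‖bw‖ ^ 2 + 2 * t * inner ℝ bw (b i - bw) + t ^ 2 * ‖b i - bw‖ ^ 2) / (4 * c)
          = ‖bw‖ ^ 2 / (4 * c) + t * (inner ℝ bw (b i - bw) / (2 * c))
            + t * (t * (‖b i - bw‖ ^ 2 / (4 * c))) := by
        field_simp; ring
      rw [e6] at hle
      have : t * (a i - aw - inner ℝ bw (b i - bw) / (2 * c)) ≤
          t * (t * (‖b i - bw‖ ^ 2 / (4 * c))) := by linarith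
      exact le_of_mul_le_mul_left this ht0
    refine le_of_tendsto_of_tendsto (f := fun _ : ℝ => _) (b := 𝓝[>] (0 : ℝ))
      (g := fun t => t * (‖b i - bw‖ ^ 2 / (4 * c))) tendsto_const_nhds ?_ ?_
    · have : Tendsto (fun t : ℝ => t * (‖b i - bw‖ ^ 2 / (4 * c))) (𝓝 0) (𝓝 (0 * _)) :=
        (continuous_id.mul continuous_const).tendsto 0
      rw [zero_mul] at this
      exact this.mono_left nhdsWithin_le_nhds
    · filter_upwards [Ioo_mem_nhdsGT (show (0 : ℝ) < 1 by norm_num)] with t ht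
      exact key t ht.1 ht.2.le
  have e5 : aw - ‖bw‖ ^ 2 / (4 * c) ≤ 0 := hneg
  have e6 : c * ‖v i - -((1 / (2 * c)) • bw)‖ ^ 2 - inner ℝ (T i) (v i - -((1 / (2 * c)) • bw))
      = a i + ‖bw‖ ^ 2 / (4 * c) - inner ℝ bw (b i) / (2 * c) := by
    rw [sub_neg_eq_add, norm_add_sq_real, inner_add_right, real_inner_smul_right,
      real_inner_smul_right, norm_smul, mul_pow, Real.norm_eq_abs, sq_abs]
    simp only [ha, hb, inner_sub_right, real_inner_smul_right]
    rw [real_inner_comm (v i) bw, real_inner_comm (T i) bw]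
    field_simp; ring
  rw [inner_sub_right, real_inner_self_eq_norm_sq, sub_div] at hopt
  have e7 : ‖bw‖ ^ 2 / (2 * c) = 2 * (‖bw‖ ^ 2 / (4 * c)) := by field_simp; ring
  linarith

/-- A strongly monotone relation has a point at which it can be extended by the value `0`. -/
theorem exists_forall_inner_sub_nonneg_of_strongly_monotone {H : Type*} [NormedAddCommGroup H]
    [InnerProductSpace ℝ H] [CompleteSpace H] (S : Set (H × H)) {c : ℝ} (hc : 0 < c)
    (hS : ∀ p ∈ S, ∀ q ∈ S, c * ‖p.1 - q.1‖ ^ 2 ≤ inner ℝ (p.2 - q.2) (p.1 - q.1)) :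
    ∃ u : H, ∀ p ∈ S, 0 ≤ inner ℝ p.2 (p.1 - u) := by
  classical
  rcases S.eq_empty_or_nonempty with rfl | ⟨p₀, hp₀⟩
  · exact ⟨0, by simp⟩
  -- Strong monotonicity at `p₀` forces `c‖p₀.1 - u‖ ≤ ‖p₀.2‖`, so every finite subfamily enlarged
  -- by `p₀` has a solution in one weakly compact ball. Without the quadratic term the constraints
  -- are affine in `u`, hence weakly closed, and the finite intersection property applies.
  set K : Set (WeakDual ℝ H) := WeakDual.toStrongDual ⁻¹'
    Metric.closedBall (InnerProductSpace.toDual ℝ H p₀.1) (‖p₀.2‖ / c) with hK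
  have hKc : IsCompact K := WeakDual.isCompact_closedBall _ _
  have hne := hKc.inter_iInter_nonempty
    (fun p : S => {f : WeakDual ℝ H | f p.1.2 ≤ inner ℝ p.1.2 p.1.1})
    (fun p => isClosed_le (WeakDual.eval_continuous p.1.2) continuous_const) (by
      intro s
      obtain ⟨u, hu⟩ := exists_forall_mul_norm_sub_sq_le_inner
        (ι := (insert ⟨p₀, hp₀⟩ s : Finset S)) (fun i => i.1.1.1) (fun i => i.1.1.2) hc
        (fun i j => hS _ i.1.2 _ j.1.2)
      refine ⟨StrongDual.toWeakDual (InnerProductSpace.toDual ℝ H u), ?_, ?_⟩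
      · have h0 := hu ⟨⟨p₀, hp₀⟩, Finset.mem_insert_self _ _⟩
        simp only at h0
        change InnerProductSpace.toDual ℝ H u ∈ Metric.closedBall _ _
        rw [Metric.mem_closedBall, LinearIsometryEquiv.dist_map, dist_comm, dist_eq_norm]
        rw [le_div_iff₀ hc]
        have h1 := h0.trans (real_inner_le_norm _ _)
        by_cases hz : ‖p₀.1 - u‖ = 0
        · rw [hz, zero_mul]; exact norm_nonneg _
        · have hpos : 0 < ‖p₀.1 - u‖ := lt_of_le_of_ne (norm_nonneg _) (Ne.symm hz)
          nlinarith
      · simp only [Set.mem_iInter]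
        intro p hp
        have h0 := hu ⟨p, Finset.mem_insert_of_mem hp⟩
        simp only [inner_sub_right] at h0
        change InnerProductSpace.toDual ℝ H u p.1.2 ≤ _
        rw [InnerProductSpace.toDual_apply_apply, real_inner_comm]
        have : 0 ≤ c * ‖p.1.1 - u‖ ^ 2 := by positivity
        linarith)
  obtain ⟨f, -, hf⟩ := hne
  refine ⟨(InnerProductSpace.toDual ℝ H).symm (WeakDual.toStrongDual f), fun p hp => ?_⟩
  have := Set.mem_iInter.1 hf ⟨p, hp⟩
  rw [inner_sub_right, sub_nonneg, real_inner_comm, InnerProductSpace.toDual_symm_apply]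
  exact this

/-- An everywhere defined monotone operator is locally bounded. -/
theorem exists_eventually_norm_le_of_monotone {H : Type*} [NormedAddCommGroup H]
    [InnerProductSpace ℝ H] [CompleteSpace H] {G : H → H}
    (hG : ∀ u v, 0 ≤ inner ℝ (G u - G v) (u - v)) {u : ℕ → H} {x : H}
    (hu : Tendsto u atTop (𝓝 x)) : ∃ C : ℝ, ∀ᶠ n in atTop, ‖G (u n)‖ ≤ C := by
  have hu' : Tendsto (fun n => ‖u n - x‖) atTop (𝓝 0) := by
    simpa using (hu.sub_const x).norm
  obtain ⟨R, hR⟩ := hu'.bddAbove_range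
  have hR' : ∀ n, ‖u n - x‖ ≤ R := fun n => hR ⟨n, rfl⟩
  -- Monotonicity against `x + h` bounds `⟨G (u n), h⟩` by `⟨G (u n), u n - x⟩` plus a term
  -- depending only on `h`. After division by `a n` the functionals are pointwise bounded, so
  -- Banach–Steinhaus applies.
  set a : ℕ → ℝ := fun n => 1 + ‖G (u n)‖ * ‖u n - x‖ with ha
  have ha1 : ∀ n, 1 ≤ a n := fun n => by
    simp only [ha]
    linarith [mul_nonneg (norm_nonneg (G (u n))) (norm_nonneg (u n - x))]
  have ha0 : ∀ n, 0 < a n := fun n => zero_lt_one.trans_le (ha1 n)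
  have hbd : ∀ n h, inner ℝ (G (u n)) h ≤ a n * (1 + ‖G (x + h)‖ * (R + ‖h‖)) := by
    intro n h
    have h1 := hG (u n) (x + h)
    have h2 : inner ℝ (G (u n) - G (x + h)) (u n - (x + h)) =
        inner ℝ (G (u n)) (u n - x) - inner ℝ (G (u n)) h
          - inner ℝ (G (x + h)) ((u n - x) - h) := by
      rw [← sub_sub, inner_sub_left, inner_sub_right (G (u n))]
    have h3 := real_inner_le_norm (G (u n)) (u n - x)
    have h4 := (abs_le.1 (abs_real_inner_le_norm (G (x + h)) ((u n - x) - h))).1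
    have h5 : ‖(u n - x) - h‖ ≤ R + ‖h‖ := (norm_sub_le _ _).trans (by linarith [hR' n])
    have h6 : ‖G (x + h)‖ * ‖(u n - x) - h‖ ≤ ‖G (x + h)‖ * (R + ‖h‖) := by gcongr
    have h7 : 0 ≤ ‖G (x + h)‖ * (R + ‖h‖) := le_trans (by positivity) h6
    have h8 : ‖G (u n)‖ * ‖u n - x‖ = a n - 1 := by simp [ha]
    nlinarith [ha1 n]
  obtain ⟨C, hC⟩ := banach_steinhaus (g := fun n => (a n)⁻¹ • innerSL ℝ (G (u n))) (by
    intro h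
    refine ⟨(1 + ‖G (x + h)‖ * (R + ‖h‖)) + (1 + ‖G (x + -h)‖ * (R + ‖-h‖)), fun n => ?_⟩
    have h1 := hbd n h
    have h2 := hbd n (-h)
    rw [inner_neg_right] at h2
    have hRn : 0 ≤ R := (norm_nonneg _).trans (hR' n)
    have h3 : 0 ≤ 1 + ‖G (x + h)‖ * (R + ‖h‖) := by positivity
    have h4 : 0 ≤ 1 + ‖G (x + -h)‖ * (R + ‖-h‖) := by positivity
    rw [_root_.smul_apply, innerSL_apply_apply, norm_smul, norm_inv,
      Real.norm_of_nonneg (ha0 n).le, inv_mul_le_iff₀ (ha0 n), Real.norm_eq_abs, abs_le]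
    constructor <;> nlinarith [ha0 n, mul_nonneg (ha0 n).le h3, mul_nonneg (ha0 n).le h4])
  have hC' : ∀ n, ‖G (u n)‖ ≤ C * a n := by
    intro n
    have := hC n
    rw [norm_smul, norm_inv, Real.norm_of_nonneg (ha0 n).le, innerSL_apply_norm,
      inv_mul_le_iff₀ (ha0 n)] at this
    linarith
  have hC0 : 0 ≤ C := by
    have := (norm_nonneg _).trans (hC' 0)
    exact nonneg_of_mul_nonneg_left this (ha0 0)
  refine ⟨2 * C, ?_⟩
  have hsmall : ∀ᶠ n in atTop, ‖u n - x‖ < 1 / (2 * C + 1) :=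
    hu'.eventually_lt_const (by positivity)
  filter_upwards [hsmall] with n hn
  have h1 := hC' n
  -- Close to `x` the term `C * ‖u n - x‖ * ‖G (u n)‖` is absorbed into the left side.
  have h2 : C * ‖u n - x‖ ≤ 1 / 2 := by
    have : ‖u n - x‖ * (2 * C + 1) < 1 := (lt_div_iff₀ (by positivity)).1 hn
    nlinarith [norm_nonneg (u n - x)]
  have h3 : ‖G (u n)‖ ≤ C + (C * ‖u n - x‖) * ‖G (u n)‖ := by
    calc _ ≤ C * a n := h1
      _ = _ := by simp only [ha]; ring
  nlinarith [norm_nonneg (G (u n))]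

/-! ### Maximal skew relations and their monotone perturbations -/

section SkewRelation

variable {H : Type*} [NormedAddCommGroup H] [InnerProductSpace ℝ H] {Γ : Submodule ℝ (H × H)}

/-- Skewness removes the cross term, so the right side squared is `‖p.1‖² + ‖r • p.2‖²`: resolvents
are nonexpansive. -/
theorem norm_fst_le_norm_sub_smul_of_skew (hskew : ∀ p ∈ Γ, inner ℝ p.2 p.1 = 0) {p : H × H}
    (hp : p ∈ Γ) (r : ℝ) : ‖p.1‖ ≤ ‖p.1 - r • p.2‖ := by
  refine le_of_sq_le_sq ?_ (norm_nonneg _)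
  rw [norm_sub_sq_real, real_inner_smul_right, real_inner_comm, hskew p hp]
  nlinarith [sq_nonneg ‖r • p.2‖]

/-- Write `h = p.1 - p.2` with `p ∈ Γ`; pairing with `p.1` leaves `‖p.1‖² = 0`, and
single-valuedness at `0` disposes of `p.2`. This is density of the domain in its orthogonal form. -/
theorem eq_zero_of_forall_inner_fst_eq_zero (hskew : ∀ p ∈ Γ, inner ℝ p.2 p.1 = 0)
    (hsingle : ∀ z, ((0 : H), z) ∈ Γ → z = 0)
    (hrange : ∀ r : ℝ, 0 < r → ∀ f, ∃ p ∈ Γ, p.1 - r • p.2 = f) {h : H}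
    (hh : ∀ p ∈ Γ, inner ℝ h p.1 = 0) : h = 0 := by
  obtain ⟨p, hp, rfl⟩ := hrange 1 one_pos h
  have h1 := hh p hp
  rw [inner_sub_left, real_inner_smul_left, hskew p hp, mul_zero, sub_zero,
    inner_self_eq_zero] at h1
  have h2 : p.2 = 0 := hsingle _ (by rw [← h1]; exact hp)
  simp [h1, h2]

theorem exists_norm_sub_fst_lt_of_skew [CompleteSpace H] (hskew : ∀ p ∈ Γ, inner ℝ p.2 p.1 = 0)
    (hsingle : ∀ z, ((0 : H), z) ∈ Γ → z = 0)
    (hrange : ∀ r : ℝ, 0 < r → ∀ f, ∃ p ∈ Γ, p.1 - r • p.2 = f) (x : H) {ε : ℝ} (hε : 0 < ε) :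
    ∃ p ∈ Γ, ‖x - p.1‖ < ε := by
  have h1 : (Γ.map (LinearMap.fst ℝ H H)).topologicalClosure = ⊤ := by
    rw [Submodule.topologicalClosure_eq_top_iff, Submodule.eq_bot_iff]
    intro h hh
    refine eq_zero_of_forall_inner_fst_eq_zero hskew hsingle hrange fun p hp => ?_
    rw [real_inner_comm]
    exact (Submodule.mem_orthogonal _ _).1 hh _ (Submodule.mem_map_of_mem hp)
  have h2 : x ∈ closure ((Γ.map (LinearMap.fst ℝ H H) : Submodule ℝ H) : Set H) := by
    rw [← Submodule.topologicalClosure_coe, h1]; trivial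
  obtain ⟨y, hy, hxy⟩ := Metric.mem_closure_iff.1 h2 ε hε
  obtain ⟨p, hp, rfl⟩ := (Submodule.mem_map.1 hy)
  exact ⟨p, hp, by rwa [dist_eq_norm] at hxy⟩

/-- The values `z n` of a skew relation along a resolvent sequence form a Cauchy sequence if they
are bounded. -/
theorem cauchySeq_of_skew_of_bounded (hskew : ∀ p ∈ Γ, inner ℝ p.2 p.1 = 0) {x : H} {C : ℝ}
    {ε : ℕ → ℝ} (hε : ∀ n, 0 < ε n) (hanti : Antitone ε) {p : ℕ → H × H} (hp : ∀ n, p n ∈ Γ)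
    (hpx : ∀ n, (p n).1 - ε n • (p n).2 = x) (hC : ∀ᶠ n in atTop, ‖(p n).2‖ ≤ C) :
    CauchySeq fun n => (p n).2 := by
  -- Subtracting two resolvent equations and using skewness gives `⟨zₙ - zₘ, εₙzₙ - εₘzₘ⟩ = 0`. So
  -- the norms increase as `ε` decreases, and `‖zₙ - zₘ‖² ≤ ‖zₘ‖² - ‖zₙ‖²`, which makes a bounded
  -- sequence Cauchy.
  have key : ∀ n m, n ≤ m → ‖(p n).2‖ ≤ ‖(p m).2‖ ∧
      ‖(p n).2‖ ^ 2 ≤ inner ℝ (p n).2 (p m).2 := by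
    intro n m hnm
    have h1 := hskew _ (Γ.sub_mem (hp n) (hp m))
    have h2 : (p n - p m).1 = ε n • (p n).2 - ε m • (p m).2 := by
      rw [Prod.fst_sub, eq_add_of_sub_eq (hpx n), eq_add_of_sub_eq (hpx m)]; abel
    rw [h2, Prod.snd_sub] at h1
    simp only [inner_sub_left, inner_sub_right, real_inner_smul_right,
      real_inner_self_eq_norm_sq] at h1
    rw [real_inner_comm (p n).2 (p m).2] at h1
    have h3 := real_inner_le_norm (p n).2 (p m).2
    set s : ℝ := inner ℝ (p n).2 (p m).2
    set a := ‖(p n).2‖ with ha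
    set b := ‖(p m).2‖ with hb
    have ha0 : 0 ≤ a := norm_nonneg _
    have hb0 : 0 ≤ b := norm_nonneg _
    have hεn := hε n
    have hεm := hε m
    have hmn := hanti hnm
    have hab : a ≤ b := by
      by_contra! hlt
      have h4 : (ε n + ε m) * s ≤ (ε n + ε m) * (a * b) := by gcongr
      have h5 : (a - b) * (ε n * a - ε m * b) ≤ 0 := by nlinarith
      have h6 : 0 < ε n * a - ε m * b := by nlinarith
      nlinarith
    refine ⟨hab, ?_⟩
    have h4 : ε m * a ^ 2 ≤ ε m * b ^ 2 := by gcongr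
    have h5 : (ε n + ε m) * a ^ 2 ≤ (ε n + ε m) * s := by nlinarith
    exact le_of_mul_le_mul_left h5 (by linarith)
  have hmono : Monotone fun n => ‖(p n).2‖ ^ 2 := fun n m hnm => by
    have := (key n m hnm).1
    simp only; gcongr
  have hbdd : BddAbove (Set.range fun n => ‖(p n).2‖ ^ 2) := by
    obtain ⟨N, hN⟩ := eventually_atTop.1 hC
    refine ⟨C ^ 2, ?_⟩
    rintro _ ⟨n, rfl⟩
    have h1 := (key n (max n N) (le_max_left _ _)).1
    have h2 := hN (max n N) (le_max_right _ _)
    have := h1.trans h2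
    simp only; gcongr
  have hcau := (tendsto_atTop_ciSup hmono hbdd).cauchySeq
  rw [Metric.cauchySeq_iff'] at hcau ⊢
  intro δ hδ
  obtain ⟨N, hN⟩ := hcau (δ ^ 2) (by positivity)
  refine ⟨N, fun n hn => ?_⟩
  have h1 := hN n hn
  have h2 := (key N n hn).2
  rw [Real.dist_eq] at h1
  have h3 := (abs_lt.1 h1).2
  rw [dist_eq_norm]
  refine lt_of_pow_lt_pow_left₀ 2 hδ.le ?_
  rw [norm_sub_sq_real, real_inner_comm]
  linarith

/-- A maximal skew relation is closed. -/
theorem mem_of_tendsto_of_skew (hskew : ∀ p ∈ Γ, inner ℝ p.2 p.1 = 0)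
    (hrange : ∀ r : ℝ, 0 < r → ∀ f, ∃ p ∈ Γ, p.1 - r • p.2 = f) {p : ℕ → H × H}
    (hp : ∀ n, p n ∈ Γ) {x z : H} (hx : Tendsto (fun n => (p n).1) atTop (𝓝 x))
    (hz : Tendsto (fun n => (p n).2) atTop (𝓝 z)) : (x, z) ∈ Γ := by
  -- The resolvent produces a candidate `q ∈ Γ` with `q.1 - q.2 = x - z`; nonexpansiveness forces
  -- `(p n).1 → q.1`, so `q = (x, z)`.
  obtain ⟨q, hq, hqe⟩ := hrange 1 one_pos (x - z)
  rw [one_smul] at hqe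
  have h1 : Tendsto (fun n => (p n - q).1) atTop (𝓝 0) := by
    refine squeeze_zero_norm (a := fun n => ‖((p n).1 - (p n).2) - (x - z)‖) (fun n => ?_) ?_
    · have := norm_fst_le_norm_sub_smul_of_skew hskew (Γ.sub_mem (hp n) hq) 1
      rw [one_smul, Prod.snd_sub] at this
      refine this.trans (le_of_eq ?_)
      rw [← hqe, Prod.fst_sub]; congr 1; abel
    · simpa using ((hx.sub hz).sub_const (x - z)).norm
  have h2 : Tendsto (fun n => (p n - q).1) atTop (𝓝 (x - q.1)) := hx.sub_const q.1
  have h3 : q.1 = x := (sub_eq_zero.1 (tendsto_nhds_unique h2 h1)).symm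
  have h4 : q.2 = z := by rw [h3] at hqe; exact sub_right_injective hqe
  rw [← h3, ← h4]; exact hq

/-- The sum of a maximal skew linear relation and a strongly monotone, hemicontinuous operator is
onto. -/
theorem exists_mem_sub_eq_of_skew [CompleteSpace H] (hskew : ∀ p ∈ Γ, inner ℝ p.2 p.1 = 0)
    (hsingle : ∀ z, ((0 : H), z) ∈ Γ → z = 0)
    (hrange : ∀ r : ℝ, 0 < r → ∀ f, ∃ p ∈ Γ, p.1 - r • p.2 = f) {G : H → H} {c : ℝ} (hc : 0 < c)
    (hG : ∀ u v, c * ‖u - v‖ ^ 2 ≤ inner ℝ (G u - G v) (u - v))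
    (hemi : ∀ x w, Tendsto (fun n : ℕ => inner ℝ (G (x + (1 / ((n : ℝ) + 1)) • w)) w) atTop
      (𝓝 (inner ℝ (G x) w))) (f : H) :
    ∃ p ∈ Γ, G p.1 - p.2 = f := by
  -- The skew part does not affect strong monotonicity. The resulting `x` is only a weak candidate;
  -- it is not yet known to lie in the domain of `Γ`.
  obtain ⟨x, hx⟩ := exists_forall_inner_sub_nonneg_of_strongly_monotone
    ((fun p : H × H => (p.1, G p.1 - p.2 - f)) '' (Γ : Set (H × H))) hc (by
      rintro _ ⟨p, hp, rfl⟩ _ ⟨q, hq, rfl⟩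
      have h1 := hG p.1 q.1
      have h2 := hskew _ (Γ.sub_mem hp hq)
      have h3 : G p.1 - p.2 - f - (G q.1 - q.2 - f) = (G p.1 - G q.1) - (p - q).2 := by
        rw [Prod.snd_sub]; abel
      simp only
      rw [h3, inner_sub_left, ← Prod.fst_sub, h2, sub_zero]
      exact h1)
  have hx' : ∀ p ∈ Γ, 0 ≤ inner ℝ (G p.1 - p.2 - f) (p.1 - x) := fun p hp =>
    hx _ ⟨p, hp, rfl⟩
  set ε : ℕ → ℝ := fun n => 1 / ((n : ℝ) + 1) with hεdef
  have hε : ∀ n, 0 < ε n := fun n => by simp only [hεdef]; positivity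
  have hanti : Antitone ε := fun n m hnm => by
    simp only [hεdef]; gcongr
  have hε0 : Tendsto ε atTop (𝓝 0) := tendsto_one_div_add_atTop_nhds_zero_nat
  -- Resolvents of `x`: the first components lie in the domain, and the second ones are the Yosida
  -- approximations.
  choose p hp hpx using fun n => hrange (ε n) (hε n) x
  have hpux : Tendsto (fun n => (p n).1) atTop (𝓝 x) := by
    rw [Metric.tendsto_atTop']
    intro δ hδ
    -- Strong convergence of the resolvents to the identity, by comparison with a domain point near
    -- `x`.
    obtain ⟨q, hq, hxq⟩ := exists_norm_sub_fst_lt_of_skew hskew hsingle hrange x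
      (show 0 < δ / 3 by positivity)
    have h1 : ∀ᶠ n in atTop, ε n * ‖q.2‖ < δ / 3 := by
      have := hε0.mul_const ‖q.2‖
      rw [zero_mul] at this
      exact this.eventually_lt_const (by positivity)
    obtain ⟨N, hN⟩ := eventually_atTop.1 h1
    refine ⟨N, fun n hn => ?_⟩
    have h2 := norm_fst_le_norm_sub_smul_of_skew hskew (Γ.sub_mem (hp n) hq) (ε n)
    have h3 : (p n - q).1 - ε n • (p n - q).2 = (x - q.1) + ε n • q.2 := by
      rw [← hpx n, Prod.fst_sub, Prod.snd_sub, smul_sub]; abel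
    rw [h3] at h2
    have h4 := h2.trans (norm_add_le _ _)
    rw [norm_smul, Real.norm_of_nonneg (hε n).le] at h4
    rw [dist_eq_norm]
    have h5 : (p n).1 - x = (p n - q).1 - (x - q.1) := by rw [Prod.fst_sub]; abel
    rw [h5]
    have h6 := norm_sub_le (p n - q).1 (x - q.1)
    have h7 := hN n hn.le
    linarith
  obtain ⟨C, hC⟩ := exists_eventually_norm_le_of_monotone (G := G)
    (fun u v => le_trans (by positivity) (hG u v)) hpux
  -- Testing the variational inequality at `p n`, where `(p n).1 - x = ε n • (p n).2`, gives `‖zₙ‖²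
  -- ≤ ⟨G (p n).1 - f, zₙ⟩` for `zₙ = (p n).2`, and `G` is bounded along the sequence.
  have hzb : ∀ᶠ n in atTop, ‖(p n).2‖ ≤ C + ‖f‖ := by
    filter_upwards [hC] with n hn
    have h1 := hx' _ (hp n)
    have h2 : (p n).1 - x = ε n • (p n).2 := by rw [← hpx n]; abel
    rw [h2, real_inner_smul_right] at h1
    have h3 := nonneg_of_mul_nonneg_right h1 (hε n)
    have h4 : G (p n).1 - (p n).2 - f = (G (p n).1 - f) - (p n).2 := by abel
    rw [h4, inner_sub_left, real_inner_self_eq_norm_sq] at h3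
    have h5 := real_inner_le_norm (G (p n).1 - f) (p n).2
    have h6 := norm_sub_le (G (p n).1) f
    rcases eq_or_lt_of_le (norm_nonneg (p n).2) with h7 | h7
    · rw [← h7]; linarith [norm_nonneg (G (p n).1), norm_nonneg f]
    · have h8 : ‖(p n).2‖ * ‖(p n).2‖ ≤ ‖G (p n).1 - f‖ * ‖(p n).2‖ := by nlinarith
      linarith [le_of_mul_le_mul_right h8 h7]
  obtain ⟨z, hz⟩ := cauchySeq_tendsto_of_complete
    (cauchySeq_of_skew_of_bounded hskew hε hanti hp hpx hzb)
  have hmem : (x, z) ∈ Γ := mem_of_tendsto_of_skew hskew hrange hp hpux hz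
  refine ⟨_, hmem, ?_⟩
  -- Minty's trick: test at `(x, z) + ε n • w`, divide by `ε n`, and pass to the limit by
  -- hemicontinuity. The domain is a subspace, so `-w` gives the reverse inequality.
  have hge : ∀ w ∈ Γ, 0 ≤ inner ℝ (G x - z - f) w.1 := by
    intro w hw
    have h1 : ∀ n : ℕ, inner ℝ (z + f) w.1 ≤ inner ℝ (G (x + ε n • w.1)) w.1 := by
      intro n
      have h2 := hx' _ (Γ.add_mem hmem (Γ.smul_mem (ε n) hw))
      simp only [Prod.fst_add, Prod.snd_add, Prod.smul_fst, Prod.smul_snd, add_sub_cancel_left,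
        real_inner_smul_right] at h2
      have h3 := nonneg_of_mul_nonneg_right h2 (hε n)
      have h4 := hskew w hw
      simp only [inner_sub_left, inner_add_left, real_inner_smul_left, h4] at h3 ⊢
      linarith
    have h2 := ge_of_tendsto' (hemi x w.1) h1
    rw [sub_sub, inner_sub_left]
    linarith
  rw [← sub_eq_zero]
  refine eq_zero_of_forall_inner_fst_eq_zero hskew hsingle hrange fun w hw => ?_
  have h1 := hge w hw
  have h2 := hge _ (Γ.neg_mem hw)
  rw [Prod.fst_neg, inner_neg_right] at h2
  simp only
  linarith

end SkewRelation

/-! ### The Maxwell operator is maximal skew -/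

section Maxwell

theorem partialD_eq_fderiv_apply {φ : R3 → R3} {x : R3} (hφ : DifferentiableAt ℝ φ x)
    (i j : Fin 3) :
    partialD φ i j x = fderiv ℝ (fun y => φ y j) x (EuclideanSpace.single i 1) := by
  have h : HasFDerivAt (fun y => φ y j)
      ((EuclideanSpace.proj j : R3 →L[ℝ] ℝ).comp (fderiv ℝ φ x)) x :=
    (EuclideanSpace.proj j : R3 →L[ℝ] ℝ).hasFDerivAt.comp x hφ.hasFDerivAt
  rw [h.fderiv]; rfl

theorem continuous_partialD {φ : R3 → R3} (hφ : ContDiff ℝ (⊤ : ℕ∞) φ) (i j : Fin 3) :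
    Continuous (partialD φ i j) := by
  have h : Continuous (fderiv ℝ φ) := hφ.continuous_fderiv (by simp)
  exact (EuclideanSpace.proj j : R3 →L[ℝ] ℝ).continuous.comp (h.clm_apply continuous_const)

theorem continuous_curl {φ : R3 → R3} (hφ : ContDiff ℝ (⊤ : ℕ∞) φ) : Continuous (curl φ) := by
  refine (PiLp.continuous_toLp 2 _).comp (continuous_pi fun k => ?_)
  fin_cases k <;> exact (continuous_partialD hφ _ _).sub (continuous_partialD hφ _ _)

theorem curl_eq_zero_of_notMem_tsupport {φ : R3 → R3} {x : R3} (hx : x ∉ tsupport φ) :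
    curl φ x = 0 := by
  have h : fderiv ℝ φ x = 0 := by
    have := notMem_tsupport_iff_eventuallyEq.1 hx
    rw [this.fderiv_eq]; simp
  ext k
  fin_cases k <;> simp [curl, partialD, h]

theorem hasCompactSupport_curl {φ : R3 → R3} (hc : HasCompactSupport φ) :
    HasCompactSupport (curl φ) :=
  HasCompactSupport.intro hc fun _ hx => curl_eq_zero_of_notMem_tsupport hx

theorem inner_R3 (a b : R3) : inner ℝ a b = a 0 * b 0 + a 1 * b 1 + a 2 * b 2 := by
  rw [PiLp.inner_apply, Fin.sum_univ_three]
  simp [mul_comm]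

/-- Integration by parts on the whole space; compact support of `φ` alone makes all products
integrable. -/
theorem integral_partialD_mul_eq_neg {φ ψ : R3 → R3} (hφ : ContDiff ℝ (⊤ : ℕ∞) φ)
    (hφc : HasCompactSupport φ) (hψ : ContDiff ℝ (⊤ : ℕ∞) ψ) (i j k : Fin 3) :
    Integrable (fun x => partialD φ i j x * ψ x k) ∧
    Integrable (fun x => φ x j * partialD ψ i k x) ∧
    ∫ x, partialD φ i j x * ψ x k = -∫ x, φ x j * partialD ψ i k x := by
  have hφd : Differentiable ℝ φ := hφ.differentiable (by simp)
  have hψd : Differentiable ℝ ψ := hψ.differentiable (by simp)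
  have cφ : ∀ j, Continuous fun x => φ x j := fun j =>
    (EuclideanSpace.proj j : R3 →L[ℝ] ℝ).continuous.comp hφ.continuous
  have cψ : ∀ j, Continuous fun x => ψ x j := fun j =>
    (EuclideanSpace.proj j : R3 →L[ℝ] ℝ).continuous.comp hψ.continuous
  have sφ : ∀ j, HasCompactSupport fun x => φ x j := fun j =>
    hφc.comp_left (g := fun y : R3 => y j) rfl
  have sD : HasCompactSupport (partialD φ i j) := by
    refine HasCompactSupport.intro hφc fun x hx => ?_
    have h : fderiv ℝ φ x = 0 := by
      have := notMem_tsupport_iff_eventuallyEq.1 hx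
      rw [this.fderiv_eq]; simp
    simp [partialD, h]
  have i1 : Integrable (fun x => partialD φ i j x * ψ x k) :=
    ((continuous_partialD hφ i j).mul (cψ k)).integrable_of_hasCompactSupport sD.mul_right
  have i2 : Integrable (fun x => φ x j * partialD ψ i k x) :=
    ((cφ j).mul (continuous_partialD hψ i k)).integrable_of_hasCompactSupport (sφ j).mul_right
  have i3 : Integrable (fun x => φ x j * ψ x k) :=
    ((cφ j).mul (cψ k)).integrable_of_hasCompactSupport (sφ j).mul_right
  refine ⟨i1, i2, ?_⟩
  have e1 : ∀ x, partialD φ i j x = fderiv ℝ (fun y => φ y j) x (EuclideanSpace.single i 1) :=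
    fun x => partialD_eq_fderiv_apply (hφd x) i j
  have e2 : ∀ x, partialD ψ i k x = fderiv ℝ (fun y => ψ y k) x (EuclideanSpace.single i 1) :=
    fun x => partialD_eq_fderiv_apply (hψd x) i k
  simp only [e1] at i1 ⊢
  simp only [e2] at i2 ⊢
  rw [integral_mul_fderiv_eq_neg_fderiv_mul_of_integrable i1 i2 i3, neg_neg]
  · exact fun x _ => ((EuclideanSpace.proj j : R3 →L[ℝ] ℝ).differentiableAt).comp x (hφd x)
  · exact fun x _ => ((EuclideanSpace.proj k : R3 →L[ℝ] ℝ).differentiableAt).comp x (hψd x)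

theorem integral_sub_add_sub_add_sub {α : Type*} {mα : MeasurableSpace α} {μ : Measure α}
    {a b c d e f : α → ℝ} (ha : Integrable a μ) (hb : Integrable b μ) (hc : Integrable c μ)
    (hd : Integrable d μ) (he : Integrable e μ) (hf : Integrable f μ) :
    ∫ x, a x - b x + (c x - d x) + (e x - f x) ∂μ =
      ∫ x, a x ∂μ - ∫ x, b x ∂μ + (∫ x, c x ∂μ - ∫ x, d x ∂μ) +
        (∫ x, e x ∂μ - ∫ x, f x ∂μ) := by
  change ∫ x, (a - b + (c - d) + (e - f)) x ∂μ = _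
  rw [integral_add' ((ha.sub hb).add (hc.sub hd)) (he.sub hf),
    integral_add' (ha.sub hb) (hc.sub hd), integral_sub' ha hb, integral_sub' hc hd,
    integral_sub' he hf]

/-- The classical curl is symmetric on test fields. -/
theorem integral_inner_curl_comm {φ ψ : R3 → R3} (hφ : ContDiff ℝ (⊤ : ℕ∞) φ)
    (hφc : HasCompactSupport φ) (hψ : ContDiff ℝ (⊤ : ℕ∞) ψ) :
    ∫ x, inner ℝ (curl φ x) (ψ x) = ∫ x, inner ℝ (φ x) (curl ψ x) := by
  have h := fun i j k => integral_partialD_mul_eq_neg hφ hφc hψ i j k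
  have e1 : ∀ x, inner ℝ (curl φ x) (ψ x) =
      partialD φ 1 2 x * ψ x 0 - partialD φ 2 1 x * ψ x 0 +
      (partialD φ 2 0 x * ψ x 1 - partialD φ 0 2 x * ψ x 1) +
      (partialD φ 0 1 x * ψ x 2 - partialD φ 1 0 x * ψ x 2) := by
    intro x; rw [inner_R3]; simp [curl, sub_mul]
  have e2 : ∀ x, inner ℝ (φ x) (curl ψ x) =
      φ x 0 * partialD ψ 1 2 x - φ x 0 * partialD ψ 2 1 x +
      (φ x 1 * partialD ψ 2 0 x - φ x 1 * partialD ψ 0 2 x) +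
      (φ x 2 * partialD ψ 0 1 x - φ x 2 * partialD ψ 1 0 x) := by
    intro x; rw [inner_R3]; simp [curl, mul_sub]
  simp_rw [e1, e2]
  have A := fun i j k => (h i j k).1
  have A' := fun i j k => (h i j k).2.1
  rw [integral_sub_add_sub_add_sub (A _ _ _) (A _ _ _) (A _ _ _) (A _ _ _) (A _ _ _) (A _ _ _),
    integral_sub_add_sub_add_sub (A' _ _ _) (A' _ _ _) (A' _ _ _) (A' _ _ _) (A' _ _ _) (A' _ _ _)]
  simp only [(h _ _ _).2.2]
  ring

variable {Θ : Set R3}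

theorem memLp_of_continuous_of_hasCompactSupport {φ : R3 → R3} (hφ : Continuous φ)
    (hc : HasCompactSupport φ) : MemLp φ 2 (volume.restrict Θ) :=
  hφ.memLp_of_hasCompactSupport hc

/-- The weak curl, in terms of the inner product of `L²(Θ)³`. -/
theorem isWeakCurl_iff {v c : L2Vec Θ} : IsWeakCurl Θ v c ↔
    ∀ (φ : R3 → R3) (hφ : ContDiff ℝ (⊤ : ℕ∞) φ) (hc : HasCompactSupport φ), tsupport φ ⊆ Θ →
      inner ℝ c ((memLp_of_continuous_of_hasCompactSupport hφ.continuous hc).toLp φ : L2Vec Θ) =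
        inner ℝ v ((memLp_of_continuous_of_hasCompactSupport (continuous_curl hφ)
          (hasCompactSupport_curl hc)).toLp (curl φ) : L2Vec Θ) := by
  have h : ∀ (a : L2Vec Θ) (ψ : R3 → R3) (hψ : MemLp ψ 2 (volume.restrict Θ)),
      inner ℝ a (hψ.toLp ψ) = ∫ x in Θ, inner ℝ (a x) (ψ x) := by
    intro a ψ hψ
    rw [L2.inner_def]
    refine integral_congr_ae ?_
    filter_upwards [hψ.coeFn_toLp] with x hx
    rw [hx]
  simp only [IsWeakCurl, h]

theorem isWeakCurl_zero : IsWeakCurl Θ 0 0 := by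
  rw [isWeakCurl_iff]; intros; simp

theorem IsWeakCurl.add {v c v' c' : L2Vec Θ} (h : IsWeakCurl Θ v c) (h' : IsWeakCurl Θ v' c') :
    IsWeakCurl Θ (v + v') (c + c') := by
  rw [isWeakCurl_iff] at *
  intro φ hφ hc hs
  rw [inner_add_left, inner_add_left, h φ hφ hc hs, h' φ hφ hc hs]

theorem IsWeakCurl.smul {v c : L2Vec Θ} (r : ℝ) (h : IsWeakCurl Θ v c) :
    IsWeakCurl Θ (r • v) (r • c) := by
  rw [isWeakCurl_iff] at *
  intro φ hφ hc hs
  rw [real_inner_smul_left, real_inner_smul_left, h φ hφ hc hs]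

theorem isWeakCurl_toLp {φ : R3 → R3} (hφ : ContDiff ℝ (⊤ : ℕ∞) φ) (hc : HasCompactSupport φ) :
    IsWeakCurl Θ ((memLp_of_continuous_of_hasCompactSupport hφ.continuous hc).toLp φ)
      ((memLp_of_continuous_of_hasCompactSupport (continuous_curl hφ)
          (hasCompactSupport_curl hc)).toLp (curl φ)) := by
  intro ψ hψ hψc hψs
  have h1 := (memLp_of_continuous_of_hasCompactSupport (Θ := Θ) hφ.continuous hc).coeFn_toLp
  have h2 := (memLp_of_continuous_of_hasCompactSupport (Θ := Θ) (continuous_curl hφ)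
          (hasCompactSupport_curl hc)).coeFn_toLp
  have e1 : ∫ x in Θ, inner ℝ ((memLp_of_continuous_of_hasCompactSupport (Θ := Θ)
      (continuous_curl hφ) (hasCompactSupport_curl hc)).toLp (curl φ) x) (ψ x) =
      ∫ x in Θ, inner ℝ (curl φ x) (ψ x) := by
    refine integral_congr_ae ?_
    filter_upwards [h2] with x hx
    rw [hx]
  have e2 : ∫ x in Θ, inner ℝ ((memLp_of_continuous_of_hasCompactSupport (Θ := Θ)
      hφ.continuous hc).toLp φ x) (curl ψ x) = ∫ x in Θ, inner ℝ (φ x) (curl ψ x) := by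
    refine integral_congr_ae ?_
    filter_upwards [h1] with x hx
    rw [hx]
  rw [e1, e2, setIntegral_eq_integral_of_forall_compl_eq_zero,
    setIntegral_eq_integral_of_forall_compl_eq_zero, integral_inner_curl_comm hφ hc hψ]
  · intro x hx
    rw [curl_eq_zero_of_notMem_tsupport (fun h => hx (hψs h)), inner_zero_right]
  · intro x hx
    rw [image_eq_zero_of_notMem_tsupport (fun h => hx (hψs h)), inner_zero_right]

/-- Test fields themselves belong to `H(curl, Θ)`, so the Green identity already contains the weak
curl condition. Thus the curl with zero trace is exactly the adjoint of the curl on `H(curl, Θ)`. -/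
theorem isWeakCurlZeroTrace_of_forall_inner_eq {v c : L2Vec Θ}
    (h : ∀ w d : L2Vec Θ, IsWeakCurl Θ w d → inner ℝ c w = inner ℝ v d) :
    IsWeakCurlZeroTrace Θ v c :=
  ⟨isWeakCurl_iff.2 fun _ hφ hc _ => h _ _ (isWeakCurl_toLp hφ hc), h⟩

theorem isWeakCurlZeroTrace_iff {v c : L2Vec Θ} : IsWeakCurlZeroTrace Θ v c ↔
    ∀ w d : L2Vec Θ, IsWeakCurl Θ w d → inner ℝ c w = inner ℝ v d :=
  ⟨fun h => h.2, isWeakCurlZeroTrace_of_forall_inner_eq⟩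

/-- The graph of the Maxwell operator as a linear subspace. -/
def maxwellGraph (Θ : Set R3) : Submodule ℝ (EMSpace Θ × EMSpace Θ) where
  carrier := {p | IsMaxwell Θ p.1 p.2}
  zero_mem' := by
    refine ⟨isWeakCurl_zero, isWeakCurlZeroTrace_iff.2 fun w d _ => ?_⟩
    simp
  add_mem' := by
    rintro p q ⟨hp1, hp2⟩ ⟨hq1, hq2⟩
    refine ⟨IsWeakCurl.add hp1 hq1, isWeakCurlZeroTrace_iff.2 fun w d hwd => ?_⟩
    have h1 := hp2.2 w d hwd
    have h2 := hq2.2 w d hwd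
    simp only [Prod.fst_add, Prod.snd_add, WithLp.add_fst, WithLp.add_snd, inner_neg_left,
      inner_add_left] at h1 h2 ⊢
    linarith
  smul_mem' := by
    rintro r p ⟨hp1, hp2⟩
    refine ⟨IsWeakCurl.smul r hp1, isWeakCurlZeroTrace_iff.2 fun w d hwd => ?_⟩
    have h1 := hp2.2 w d hwd
    simp only [Prod.smul_fst, Prod.smul_snd, WithLp.smul_fst, WithLp.smul_snd, inner_neg_left,
      real_inner_smul_left] at h1 ⊢
    rw [← h1]; ring

theorem mem_maxwellGraph {p : EMSpace Θ × EMSpace Θ} :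
    p ∈ maxwellGraph Θ ↔ IsMaxwell Θ p.1 p.2 := Iff.rfl

/-- Green's formula for the electric field, tested with the magnetic field, makes the two curl terms
cancel. -/
theorem inner_eq_zero_of_mem_maxwellGraph (p : EMSpace Θ × EMSpace Θ)
    (hp : p ∈ maxwellGraph Θ) : inner ℝ p.2 p.1 = 0 := by
  obtain ⟨h1, h2⟩ := hp
  have h3 := h2.2 _ _ h1
  rw [WithLp.prod_inner_apply]
  change inner ℝ p.2.fst p.1.fst + inner ℝ p.2.snd p.1.snd = 0
  rw [inner_neg_left] at h3
  rw [real_inner_comm p.1.fst p.2.fst, ← h3]; ring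

/-- The graph `K` of `r • curl` is closed, and its orthogonal complement is the rotated graph of the
adjoint, the curl with zero trace. Splitting `(f.snd, -f.fst)` along `K ⊕ Kᗮ` yields the magnetic
field as `p.fst` and the electric field as `-q.snd`. -/
theorem exists_mem_maxwellGraph_sub_smul_eq (r : ℝ) (hr : 0 < r) (f : EMSpace Θ) :
    ∃ p ∈ maxwellGraph Θ, p.1 - r • p.2 = f := by
  let K : Submodule ℝ (EMSpace Θ) :=
    { carrier := {p | IsWeakCurl Θ p.fst (r⁻¹ • p.snd)}
      zero_mem' := by
        simpa using isWeakCurl_zero (Θ := Θ)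
      add_mem' := fun {p q} hp hq => by
        have := IsWeakCurl.add hp hq
        rwa [← smul_add] at this
      smul_mem' := fun s p hp => by
        have := IsWeakCurl.smul s hp
        rwa [smul_comm] at this }
  have hfst : Continuous fun p : EMSpace Θ => p.fst := WithLp.continuous_fst 2 _ _
  have hsnd : Continuous fun p : EMSpace Θ => p.snd := WithLp.continuous_snd 2 _ _
  have hclosed : IsClosed (K : Set (EMSpace Θ)) := by
    have : (K : Set (EMSpace Θ)) = {p | IsWeakCurl Θ p.fst (r⁻¹ • p.snd)} := rfl
    rw [this]
    simp only [isWeakCurl_iff, Set.ofPred_forall]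
    refine isClosed_iInter fun φ => isClosed_iInter fun hφ => isClosed_iInter fun hc =>
      isClosed_iInter fun _ => isClosed_eq ?_ ?_
    · exact (hsnd.const_smul r⁻¹).inner continuous_const
    · exact hfst.inner continuous_const
  have : CompleteSpace K := hclosed.completeSpace_coe
  obtain ⟨p, hp, q, hq, hpq⟩ := K.exists_add_mem_mem_orthogonal
    (WithLp.toLp 2 (f.snd, -f.fst) : EMSpace Θ)
  have h1 : f.snd = p.fst + q.fst := congrArg (fun y : EMSpace Θ => y.fst) hpq
  have h2 : -f.fst = p.snd + q.snd := congrArg (fun y : EMSpace Θ => y.snd) hpq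
  refine ⟨(WithLp.toLp 2 (-q.snd, p.fst), WithLp.toLp 2 (r⁻¹ • p.snd, -(r⁻¹ • q.fst))),
    ⟨hp, isWeakCurlZeroTrace_iff.2 fun w d hwd => ?_⟩, ?_⟩
  · have h3 : (WithLp.toLp 2 (w, r • d) : EMSpace Θ) ∈ K := by
      change IsWeakCurl Θ w (r⁻¹ • r • d)
      rwa [inv_smul_smul₀ hr.ne']
    have h4 := (Submodule.mem_orthogonal _ _).1 hq _ h3
    rw [WithLp.prod_inner_apply] at h4
    change inner ℝ w q.fst + inner ℝ (r • d) q.snd = 0 at h4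
    change inner ℝ (- -(r⁻¹ • q.fst)) w = inner ℝ (-q.snd) d
    rw [neg_neg, real_inner_smul_left, inner_neg_left, real_inner_comm, real_inner_comm d]
    rw [real_inner_smul_left] at h4
    rw [eq_neg_of_add_eq_zero_left h4]
    field_simp
  · refine WithLp.ofLp_injective 2 (Prod.ext ?_ ?_)
    · change -q.snd - r • (r⁻¹ • p.snd) = f.fst
      rw [smul_inv_smul₀ hr.ne', ← neg_neg f.fst, h2]; abel
    · change p.fst - r • -(r⁻¹ • q.fst) = f.snd
      rw [smul_neg, smul_inv_smul₀ hr.ne', h1]; abel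

/-- Test with `g eₖ` for scalar test functions `g` and use the fundamental lemma of the calculus of
variations in each component. -/
theorem eq_zero_of_isWeakCurl_zero (hΘ : IsOpen Θ) {c : L2Vec Θ} (h : IsWeakCurl Θ 0 c) :
    c = 0 := by
  have hcomp : ∀ k : Fin 3, ∀ᵐ x, x ∈ Θ → (c x) k = 0 := by
    intro k
    have hk : LocallyIntegrableOn (fun x => (c x) k) Θ := by
      have h1 : MemLp (fun x => (c x) k) 2 (volume.restrict Θ) :=
        (EuclideanSpace.proj k : R3 →L[ℝ] ℝ).comp_memLp' (Lp.memLp c)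
      exact locallyIntegrableOn_of_locallyIntegrable_restrict
        (h1.locallyIntegrable (by norm_num))
    refine hΘ.ae_eq_zero_of_integral_contDiff_smul_eq_zero hk fun g hg hgc hgs => ?_
    have h1 := h (fun x => g x • EuclideanSpace.single k (1 : ℝ)) (hg.smul contDiff_const)
      hgc.smul_right ((tsupport_smul_subset_left _ _).trans hgs)
    have h2 : ∫ x in Θ, inner ℝ ((0 : L2Vec Θ) x)
        (curl (fun x => g x • EuclideanSpace.single k (1 : ℝ)) x) = 0 := by
      refine integral_eq_zero_of_ae ?_
      filter_upwards [Lp.coeFn_zero R3 2 (volume.restrict Θ)] with x hx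
      rw [hx]; simp
    rw [h2] at h1
    rw [← setIntegral_eq_integral_of_forall_compl_eq_zero (s := Θ), ← h1]
    · refine integral_congr_ae (ae_of_all _ fun x => ?_)
      simp only [real_inner_smul_right, EuclideanSpace.inner_single_right]
      simp
    · intro x hx
      rw [image_eq_zero_of_notMem_tsupport (fun h => hx (hgs h)), zero_smul]
  refine (Lp.eq_zero_iff_ae_eq_zero).2 ((ae_restrict_iff' hΘ.measurableSet).2 ?_)
  filter_upwards [hcomp 0, hcomp 1, hcomp 2] with x h0 h1 h2 hx
  ext k
  fin_cases k
  exacts [h0 hx, h1 hx, h2 hx]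

theorem eq_zero_of_zero_mem_maxwellGraph (hΘ : IsOpen Θ) (z : EMSpace Θ)
    (hz : ((0 : EMSpace Θ), z) ∈ maxwellGraph Θ) : z = 0 := by
  obtain ⟨h1, h2, -⟩ := hz
  refine WithLp.ofLp_injective 2 (Prod.ext ?_ ?_)
  · exact eq_zero_of_isWeakCurl_zero hΘ h1
  · exact neg_eq_zero.1 (eq_zero_of_isWeakCurl_zero hΘ h2)

end Maxwell

/-! ### One-sided Lipschitz Nemytskij operators and the implicit step -/

section Nemytskij

variable {Θ : Set R3}

/-- The pointwise inner product of two electromagnetic fields. -/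
noncomputable def fieldInner (a b : EMSpace Θ) (y : R3) : ℝ :=
  inner ℝ (a.fst y) (b.fst y) + inner ℝ (a.snd y) (b.snd y)

theorem integrable_fieldInner (a b : EMSpace Θ) :
    Integrable (fieldInner a b) (volume.restrict Θ) :=
  (L2.integrable_inner (𝕜 := ℝ) a.fst b.fst).add (L2.integrable_inner (𝕜 := ℝ) a.snd b.snd)

theorem inner_eq_integral_fieldInner (a b : EMSpace Θ) :
    inner ℝ a b = ∫ y in Θ, fieldInner a b y := by
  rw [WithLp.prod_inner_apply]
  change inner ℝ a.fst b.fst + inner ℝ a.snd b.snd = _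
  rw [L2.inner_def, L2.inner_def]
  exact (integral_add (L2.integrable_inner (𝕜 := ℝ) a.fst b.fst)
    (L2.integrable_inner (𝕜 := ℝ) a.snd b.snd)).symm

theorem ae_add_smul_fst (x w : EMSpace Θ) (t : ℝ) : ∀ᵐ y ∂(volume.restrict Θ),
    (x + t • w).fst y = x.fst y + t • w.fst y ∧ (x + t • w).snd y = x.snd y + t • w.snd y := by
  filter_upwards [Lp.coeFn_add x.fst (t • w.fst), Lp.coeFn_smul t w.fst,
    Lp.coeFn_add x.snd (t • w.snd), Lp.coeFn_smul t w.snd] with y h1 h2 h3 h4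
  constructor
  · change (x.fst + t • w.fst : L2Vec Θ) y = _
    rw [h1, Pi.add_apply, h2, Pi.smul_apply]
  · change (x.snd + t • w.snd : L2Vec Θ) y = _
    rw [h3, Pi.add_apply, h4, Pi.smul_apply]

theorem ae_sub_fst (x w : EMSpace Θ) : ∀ᵐ y ∂(volume.restrict Θ),
    (x - w).fst y = x.fst y - w.fst y ∧ (x - w).snd y = x.snd y - w.snd y := by
  filter_upwards [Lp.coeFn_sub x.fst w.fst, Lp.coeFn_sub x.snd w.snd] with y h1 h2
  exact ⟨h1, h2⟩

/-- The field equal to `u` on `A` and to `v` elsewhere. -/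
theorem exists_splice (u v : EMSpace Θ) {A : Set R3} (hA : MeasurableSet A) :
    ∃ s : EMSpace Θ, ∀ᵐ y ∂(volume.restrict Θ),
      (y ∈ A → s.fst y = u.fst y ∧ s.snd y = u.snd y) ∧
      (y ∉ A → s.fst y = v.fst y ∧ s.snd y = v.snd y) := by
  classical
  have m1 : MemLp (A.piecewise u.fst v.fst) 2 (volume.restrict Θ) :=
    MemLp.piecewise hA ((Lp.memLp u.fst).restrict _) ((Lp.memLp v.fst).restrict _)
  have m2 : MemLp (A.piecewise u.snd v.snd) 2 (volume.restrict Θ) :=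
    MemLp.piecewise hA ((Lp.memLp u.snd).restrict _) ((Lp.memLp v.snd).restrict _)
  refine ⟨WithLp.toLp 2 (m1.toLp _, m2.toLp _), ?_⟩
  filter_upwards [m1.coeFn_toLp, m2.coeFn_toLp] with y h1 h2
  change (y ∈ A → m1.toLp _ y = _ ∧ m2.toLp _ y = _) ∧ (y ∉ A → m1.toLp _ y = _ ∧ m2.toLp _ y = _)
  rw [h1, h2]
  exact ⟨fun h => by simp [h], fun h => by simp [h]⟩

/-- A one-sided Lipschitz Nemytskij operator is one-sided Lipschitz pointwise. -/
theorem StochMaxwell.IsDriftNemytskij.ae_fieldInner_le {Je Jm : R3 → R3 → R3 → R3} {F : EMSpace Θ → EMSpace Θ}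
    (hF : IsDriftNemytskij Θ Je Jm F) {α : ℝ}
    (hmono : ∀ u v : EMSpace Θ, inner ℝ (u - v) (F u - F v) ≤ α * ‖u - v‖ ^ 2)
    (u v : EMSpace Θ) : ∀ᵐ y ∂(volume.restrict Θ),
      fieldInner (u - v) (F u - F v) y ≤ α * fieldInner (u - v) (u - v) y := by
  refine ae_le_of_forall_setIntegral_le (integrable_fieldInner _ _)
    ((integrable_fieldInner _ _).const_mul α) fun A hA _ => ?_
  -- Locality: if `s` equals `u` on `A` and `v` elsewhere, then `F s - F v` is supported in `A`, so
  -- the global inequality for `s, v` is the inequality for `u, v` integrated over `A`.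
  obtain ⟨s, hs⟩ := exists_splice u v hA
  have h1 := hmono s v
  rw [← real_inner_self_eq_norm_sq, inner_eq_integral_fieldInner,
    inner_eq_integral_fieldInner] at h1
  have h2 : ∀ᵐ y ∂(volume.restrict Θ),
      fieldInner (s - v) (F s - F v) y = A.indicator (fieldInner (u - v) (F u - F v)) y ∧
      fieldInner (s - v) (s - v) y = A.indicator (fieldInner (u - v) (u - v)) y := by
    filter_upwards [hs, ae_sub_fst s v, ae_sub_fst u v, ae_sub_fst (F s) (F v),
      ae_sub_fst (F u) (F v), (hF s).1, (hF s).2, (hF u).1, (hF u).2, (hF v).1, (hF v).2]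
      with y hy a1 a2 a3 a4 b1 b2 b3 b4 b5 b6
    simp only [fieldInner]
    by_cases hyA : y ∈ A
    · obtain ⟨e1, e2⟩ := hy.1 hyA
      simp only [fieldInner, Set.indicator_of_mem hyA, a1.1, a1.2, a2.1, a2.2, a3.1, a3.2, a4.1, a4.2, b1, b2,
        b3, b4, b5, b6, e1, e2, and_self]
    · obtain ⟨e1, e2⟩ := hy.2 hyA
      simp only [Set.indicator_of_notMem hyA, a1.1, a1.2, a3.1, a3.2, b1, b2, b5, b6, e1, e2,
        sub_self, inner_zero_left, add_zero, and_self]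
  rw [integral_congr_ae (h2.mono fun y hy => hy.1), integral_congr_ae (h2.mono fun y hy => hy.2),
    integral_indicator hA, integral_indicator hA] at h1
  rw [integral_const_mul]
  exact h1

theorem ae_fieldInner_smul_left (r : ℝ) (a b : EMSpace Θ) : ∀ᵐ y ∂(volume.restrict Θ),
    fieldInner (r • a) b y = r * fieldInner a b y := by
  filter_upwards [Lp.coeFn_smul r a.fst, Lp.coeFn_smul r a.snd] with y h1 h2
  have h1' : (r • a).fst y = r • a.fst y := h1
  have h2' : (r • a).snd y = r • a.snd y := h2
  simp only [fieldInner, h1', h2', real_inner_smul_left]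
  ring

theorem ae_fieldInner_sub_right (a b c : EMSpace Θ) : ∀ᵐ y ∂(volume.restrict Θ),
    fieldInner a (b - c) y = fieldInner a b y - fieldInner a c y := by
  filter_upwards [ae_sub_fst b c] with y h
  simp only [fieldInner, h.1, h.2, inner_sub_right]
  ring

theorem fieldInner_comm (a b : EMSpace Θ) (y : R3) : fieldInner a b y = fieldInner b a y := by
  simp only [fieldInner, real_inner_comm]

theorem fieldInner_self_nonneg (a : EMSpace Θ) (y : R3) : 0 ≤ fieldInner a a y :=
  add_nonneg real_inner_self_nonneg real_inner_self_nonneg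

/-- Pointwise one-sided Lipschitz bound along a line. -/
theorem StochMaxwell.IsDriftNemytskij.ae_fieldInner_line_le {Je Jm : R3 → R3 → R3 → R3}
    {F : EMSpace Θ → EMSpace Θ} (hF : IsDriftNemytskij Θ Je Jm F) {α : ℝ}
    (hmono : ∀ u v : EMSpace Θ, inner ℝ (u - v) (F u - F v) ≤ α * ‖u - v‖ ^ 2)
    (v w : EMSpace Θ) {t : ℝ} (ht0 : 0 < t) (ht1 : t ≤ 1) : ∀ᵐ y ∂(volume.restrict Θ),
      fieldInner w (F (v + t • w)) y ≤ fieldInner w (F v) y + |α| * fieldInner w w y := by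
  have h1 := hF.ae_fieldInner_le hmono (v + t • w) v
  rw [add_sub_cancel_left] at h1
  filter_upwards [h1, ae_fieldInner_smul_left t w (F (v + t • w) - F v),
    ae_fieldInner_smul_left t w (t • w), ae_fieldInner_smul_left t w w,
    ae_fieldInner_sub_right w (F (v + t • w)) (F v)] with y h1 h2 h3 h4 h5
  rw [h2, h5, h3, fieldInner_comm w (t • w), h4] at h1
  have h6 : t * (fieldInner w (F (v + t • w)) y - fieldInner w (F v) y) ≤
      t * (|α| * fieldInner w w y) := by
    refine h1.trans ?_
    have h7 := fieldInner_self_nonneg w y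
    have h8 : α * (t * fieldInner w w y) ≤ |α| * (1 * fieldInner w w y) := by
      refine (mul_le_mul_of_nonneg_right (le_abs_self α) (by positivity)).trans ?_
      gcongr
    calc α * (t * (t * fieldInner w w y)) = t * (α * (t * fieldInner w w y)) := by ring
      _ ≤ t * (|α| * (1 * fieldInner w w y)) := by gcongr
      _ = _ := by ring
  linarith [le_of_mul_le_mul_left h6 ht0]

/-- A one-sided Lipschitz Nemytskij operator of Caratheodory functions is hemicontinuous. -/
theorem StochMaxwell.IsDriftNemytskij.tendsto_inner_line {Je Jm : R3 → R3 → R3 → R3}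
    {F : EMSpace Θ → EMSpace Θ} (hF : IsDriftNemytskij Θ Je Jm F)
    (hJe : IsCaratheodory Θ Je) (hJm : IsCaratheodory Θ Jm) {α : ℝ}
    (hmono : ∀ u v : EMSpace Θ, inner ℝ (u - v) (F u - F v) ≤ α * ‖u - v‖ ^ 2)
    (x w : EMSpace Θ) :
    Tendsto (fun n : ℕ => inner ℝ (F (x + (1 / ((n : ℝ) + 1)) • w)) w) atTop
      (𝓝 (inner ℝ (F x) w)) := by
  simp_rw [real_inner_comm w, inner_eq_integral_fieldInner]
  set ε : ℕ → ℝ := fun n => 1 / ((n : ℝ) + 1) with hε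
  change Tendsto (fun n : ℕ => ∫ y in Θ, fieldInner w (F (x + ε n • w)) y) _ _
  have hε0 : Tendsto ε atTop (𝓝 0) := tendsto_one_div_add_atTop_nhds_zero_nat
  have hεpos : ∀ n, 0 < ε n := fun n => by simp only [hε]; positivity
  have hε1 : ∀ n, 1 ≤ n → ε n < 1 := fun n hn => by
    have : (1 : ℝ) ≤ n := by exact_mod_cast hn
    simp only [hε]; rw [div_lt_one (by positivity)]; linarith
  -- The line bound started at `x` controls the integrand from above; started at `x + ε n • w` and
  -- run to `x + w`, it controls the integrand from below. This dominates without any growth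
  -- condition on the nonlinearities.
  refine tendsto_integral_filter_of_dominated_convergence
    (fun y => |fieldInner w (F x) y| + |fieldInner w (F (x + w)) y| + |α| * fieldInner w w y)
    (Eventually.of_forall fun n => (integrable_fieldInner _ _).aestronglyMeasurable) ?_
    (((integrable_fieldInner _ _).abs.add (integrable_fieldInner _ _).abs).add
      ((integrable_fieldInner _ _).const_mul _)) ?_
  -- At `n = 0` the step is `ε 0 = 1`, and the second segment, of length `1 - ε n`, would be
  -- degenerate.
  · filter_upwards [eventually_ge_atTop 1] with n hn
    have h1 := hF.ae_fieldInner_line_le hmono x w (hεpos n) (hε1 n hn).le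
    have h2 := hF.ae_fieldInner_line_le hmono (x + ε n • w) w (sub_pos.2 (hε1 n hn))
      (by linarith [hεpos n])
    have h3 : x + ε n • w + (1 - ε n) • w = x + w := by
      rw [add_assoc, ← add_smul]; simp
    rw [h3] at h2
    filter_upwards [h1, h2] with y h1 h2
    rw [Real.norm_eq_abs, abs_le]
    have h4 := abs_le.1 (le_refl |fieldInner w (F x) y|)
    have h5 := abs_le.1 (le_refl |fieldInner w (F (x + w)) y|)
    have h6 : 0 ≤ |α| * fieldInner w w y := mul_nonneg (abs_nonneg _) (fieldInner_self_nonneg w y)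
    constructor <;> linarith [h4.1, h4.2, h5.1, h5.2, abs_nonneg (fieldInner w (F x) y),
      abs_nonneg (fieldInner w (F (x + w)) y)]
  · filter_upwards [hJe.2, hJm.2, (hF x).1, (hF x).2,
      ae_all_iff.2 fun n => (hF (x + ε n • w)).1, ae_all_iff.2 fun n => (hF (x + ε n • w)).2,
      ae_all_iff.2 fun n => ae_add_smul_fst x w (ε n)] with y c1 c2 e1 e2 e3 e4 e5
    have hp : Tendsto (fun n => (x.fst y + ε n • w.fst y, x.snd y + ε n • w.snd y)) atTop
        (𝓝 (x.fst y, x.snd y)) := by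
      have h1 : ∀ a b : R3, Tendsto (fun n => a + ε n • b) atTop (𝓝 a) := fun a b => by
        simpa using (hε0.smul_const b).const_add a
      exact (h1 _ _).prodMk_nhds (h1 _ _)
    simp only [fieldInner, e1, e2, e3, e4, fun n => (e5 n).1, fun n => (e5 n).2]
    exact (tendsto_const_nhds.inner ((c1.tendsto _).comp hp).neg).add
      (tendsto_const_nhds.inner ((c2.tendsto _).comp hp).neg)

/-- The implicit step of the scheme: solvability. -/
theorem exists_isMaxwell_implicit_step (hΘ : IsOpen Θ) {Je Jm : R3 → R3 → R3 → R3}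
    {F : EMSpace Θ → EMSpace Θ} (hF : IsDriftNemytskij Θ Je Jm F)
    (hJe : IsCaratheodory Θ Je) (hJm : IsCaratheodory Θ Jm) {α σ τ : ℝ}
    (hmono : ∀ u v : EMSpace Θ, inner ℝ (u - v) (F u - F v) ≤ α * ‖u - v‖ ^ 2)
    (hτ : 0 < τ) (ha : 0 < 1 + τ * (σ - α)) (f : EMSpace Θ) :
    ∃ u z : EMSpace Θ, IsMaxwell Θ u z ∧ u - f = τ • z - (σ * τ) • u + τ • F u := by
  -- Dividing the step by `τ` gives `G u - M u = τ⁻¹ • f`, where `G` has this monotonicity constant.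
  have hc : 0 < τ⁻¹ * (1 + σ * τ) - α := by
    have : τ⁻¹ * (1 + σ * τ) - α = τ⁻¹ * (1 + τ * (σ - α)) := by field_simp; ring
    rw [this]; positivity
  obtain ⟨p, hp, hpe⟩ := exists_mem_sub_eq_of_skew (Γ := maxwellGraph Θ)
    inner_eq_zero_of_mem_maxwellGraph (eq_zero_of_zero_mem_maxwellGraph hΘ)
    exists_mem_maxwellGraph_sub_smul_eq (G := fun u => (τ⁻¹ * (1 + σ * τ)) • u - F u) hc
    (fun u v => by
      have h1 : (τ⁻¹ * (1 + σ * τ)) • u - F u - ((τ⁻¹ * (1 + σ * τ)) • v - F v) =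
          (τ⁻¹ * (1 + σ * τ)) • (u - v) - (F u - F v) := by rw [smul_sub]; abel
      rw [h1, inner_sub_left, real_inner_smul_left, real_inner_self_eq_norm_sq,
        real_inner_comm (u - v) (F u - F v)]
      linarith [hmono u v])
    (fun x w => by
      simp only [inner_sub_left]
      refine Tendsto.sub ?_ (hF.tendsto_inner_line hJe hJm hmono x w)
      have h0 : Tendsto (fun n : ℕ => x + (1 / ((n : ℝ) + 1)) • w) atTop (𝓝 x) := by
        simpa using ((tendsto_one_div_add_atTop_nhds_zero_nat (𝕜 := ℝ)).smul_const w).const_add x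
      exact (h0.const_smul _).inner tendsto_const_nhds) (τ⁻¹ • f)
  refine ⟨p.1, p.2, hp, ?_⟩
  have h1 : f = τ • (τ⁻¹ • f) := by rw [smul_inv_smul₀ hτ.ne']
  rw [h1, ← hpe]
  have h2 : τ • (τ⁻¹ * (1 + σ * τ)) • p.1 = p.1 + (σ * τ) • p.1 := by
    rw [smul_smul, ← mul_assoc, mul_inv_cancel₀ hτ.ne', one_mul, add_smul, one_smul]
  rw [smul_sub, smul_sub, h2]; abel

/-- The implicit step of the scheme: Lipschitz dependence on the right-hand side. -/
theorem mul_norm_sub_le_of_implicit_step {F : EMSpace Θ → EMSpace Θ} {α σ τ : ℝ}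
    (hmono : ∀ u v : EMSpace Θ, inner ℝ (u - v) (F u - F v) ≤ α * ‖u - v‖ ^ 2)
    (hτ : 0 < τ) {u z f u' z' f' : EMSpace Θ} (hu : IsMaxwell Θ u z)
    (he : u - f = τ • z - (σ * τ) • u + τ • F u) (hu' : IsMaxwell Θ u' z')
    (he' : u' - f' = τ • z' - (σ * τ) • u' + τ • F u') :
    (1 + τ * (σ - α)) * ‖u - u'‖ ≤ ‖f - f'‖ := by
  have h1 := inner_eq_zero_of_mem_maxwellGraph _ ((maxwellGraph Θ).sub_mem
    (mem_maxwellGraph.2 (show IsMaxwell Θ (u, z).1 (u, z).2 from hu))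
    (mem_maxwellGraph.2 (show IsMaxwell Θ (u', z').1 (u', z').2 from hu')))
  simp only [Prod.fst_sub, Prod.snd_sub] at h1
  have h2 : f - f' = (1 + σ * τ) • (u - u') - τ • (z - z') - τ • (F u - F u') := by
    have e1 : f = u - (τ • z - (σ * τ) • u + τ • F u) := by rw [← he]; abel
    have e2 : f' = u' - (τ • z' - (σ * τ) • u' + τ • F u') := by rw [← he']; abel
    rw [e1, e2]; module
  -- The Maxwell contribution vanishes by skewness; only damping and drift remain.
  have h3 : inner ℝ (f - f') (u - u') =
      (1 + σ * τ) * ‖u - u'‖ ^ 2 - τ * inner ℝ (u - u') (F u - F u') := by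
    rw [h2, inner_sub_left, inner_sub_left, real_inner_smul_left, real_inner_smul_left,
      real_inner_smul_left, h1, real_inner_self_eq_norm_sq,
      real_inner_comm (u - u') (F u - F u')]
    ring
  have h4 := real_inner_le_norm (f - f') (u - u')
  have h5 : τ * inner ℝ (u - u') (F u - F u') ≤ τ * (α * ‖u - u'‖ ^ 2) := by
    gcongr; exact hmono u u'
  rcases eq_or_lt_of_le (norm_nonneg (u - u')) with h6 | h6
  · rw [← h6, mul_zero]; exact norm_nonneg _
  · refine le_of_mul_le_mul_right ?_ h6
    nlinarith

end Nemytskij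

/-! ### Random iterations contracting in mean square -/

section RandomMap

theorem eLpNorm_two_pow_two {α E : Type*} {mα : MeasurableSpace α} {μ : Measure α}
    [NormedAddCommGroup E] (f : α → E) : eLpNorm f 2 μ ^ 2 = ∫⁻ x, ‖f x‖ₑ ^ 2 ∂μ := by
  have h := eLpNorm_nnreal_pow_eq_lintegral (f := f) (μ := μ) (p := 2) (by norm_num)
  have e : ∀ a : ENNReal, a ^ (((2 : ℝ≥0) : ℝ)) = a ^ 2 := fun a => by
    rw [← ENNReal.rpow_natCast]; norm_num
  simpa only [e, ENNReal.coe_ofNat] using h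

/-- Splitting off the first coordinate of an i.i.d. sequence. -/
theorem measurePreserving_shift_prodMk_zero {Ξ : Type*} {mΞ : MeasurableSpace Ξ} (γ : Measure Ξ)
    [IsProbabilityMeasure γ] :
    MeasurePreserving (fun θ : ℕ → Ξ => ((fun n => θ (n + 1)), θ 0))
      (Measure.infinitePi fun _ : ℕ => γ) ((Measure.infinitePi fun _ : ℕ => γ).prod γ) := by
  classical
  have hm : Measurable (fun θ : ℕ → Ξ => ((fun n => θ (n + 1)), θ 0)) := by fun_prop
  -- The inverse map, prepending a coordinate. Its image law is identified on finite cylinders,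
  -- padded by `Set.univ` to an initial segment.
  set cons : (ℕ → Ξ) × Ξ → (ℕ → Ξ) := fun p n => Nat.casesOn n p.2 p.1 with hcons
  have hcm : Measurable cons := by
    refine measurable_pi_iff.2 fun n => ?_
    cases n with
    | zero => exact measurable_snd
    | succ n => exact (measurable_pi_apply n).comp measurable_fst
  have hmap : ((Measure.infinitePi fun _ : ℕ => γ).prod γ).map cons =
      Measure.infinitePi fun _ : ℕ => γ := by
    refine Measure.eq_infinitePi _ fun s t ht => ?_
    obtain ⟨N, hN⟩ : ∃ N, s ⊆ Finset.range (N + 1) :=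
      ⟨s.sup id, fun i hi => Finset.mem_range.2 (Nat.lt_succ_of_le (Finset.le_sup (f := id) hi))⟩
    set t' : ℕ → Set Ξ := fun i => if i ∈ s then t i else Set.univ with ht'
    have ht'm : ∀ i, MeasurableSet (t' i) := fun i => by
      simp only [ht']; split_ifs; exacts [ht i, MeasurableSet.univ]
    have h1 : Set.pi (s : Set ℕ) t = Set.pi (Finset.range (N + 1) : Set ℕ) t' := by
      ext x
      simp only [Set.mem_pi, Finset.mem_coe, ht']
      refine ⟨fun h i _ => ?_, fun h i hi => ?_⟩
      · split_ifs with his; exacts [h i his, trivial]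
      · simpa [hi] using h i (hN hi)
    have h2 : ∏ i ∈ s, γ (t i) = ∏ i ∈ Finset.range (N + 1), γ (t' i) := by
      rw [← Finset.prod_subset hN fun i _ hi => by simp [ht', hi]]
      exact Finset.prod_congr rfl fun i hi => by simp [ht', hi]
    have h3 : cons ⁻¹' Set.pi (Finset.range (N + 1) : Set ℕ) t' =
        Set.pi (Finset.range N : Set ℕ) (fun i => t' (i + 1)) ×ˢ t' 0 := by
      ext p
      simp only [Set.mem_preimage, Set.mem_pi, Finset.coe_range, Set.mem_Iio, Set.mem_prod]
      refine ⟨fun h => ⟨fun i hi => h (i + 1) (by omega), h 0 (by omega)⟩, fun h i hi => ?_⟩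
      cases i with
      | zero => exact h.2
      | succ i => exact h.1 i (by omega)
    rw [h1, h2, Measure.map_apply hcm (MeasurableSet.pi (Finset.countable_toSet _)
      fun i _ => ht'm i), h3, Measure.prod_prod, Measure.infinitePi_pi _ fun i _ => ht'm _,
      Finset.prod_range_succ']
  refine ⟨hm, ?_⟩
  conv_lhs => rw [← hmap]
  rw [Measure.map_map hm hcm]
  exact Measure.map_id

variable {H Ξ : Type*} [MeasurableSpace H] {mΞ : MeasurableSpace Ξ}

/-- The transition kernel of the random iteration `x ↦ G (x, ξ)` with `ξ ∼ γ`. -/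
noncomputable def randomMapKernel (γ : Measure Ξ) [SFinite γ] (G : H × Ξ → H) : Kernel H H :=
  (Kernel.id ×ₖ Kernel.const H γ).map G

theorem randomMapKernel_apply {γ : Measure Ξ} [SFinite γ] {G : H × Ξ → H} (hG : Measurable G)
    (x : H) : randomMapKernel γ G x = γ.map fun ξ => G (x, ξ) := by
  rw [randomMapKernel, Kernel.map_apply _ hG, Kernel.prod_apply, Kernel.id_apply,
    Kernel.const_apply, Measure.dirac_prod, Measure.map_map hG (by fun_prop)]
  rfl

theorem isMarkovKernel_randomMapKernel {γ : Measure Ξ} [IsProbabilityMeasure γ] {G : H × Ξ → H}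
    (hG : Measurable G) : IsMarkovKernel (randomMapKernel γ G) :=
  Kernel.IsMarkovKernel.map _ hG

theorem bind_randomMapKernel {γ : Measure Ξ} [IsProbabilityMeasure γ] {G : H × Ξ → H}
    (hG : Measurable G) (π : Measure H) [SFinite π] :
    π.bind (randomMapKernel γ G) = (π.prod γ).map G := by
  refine Measure.ext fun A hA => ?_
  rw [Measure.bind_apply hA (Kernel.aemeasurable _), Measure.map_apply hG hA,
    Measure.prod_apply (hG hA)]
  refine lintegral_congr fun x => ?_
  have hGx : Measurable fun ξ => G (x, ξ) := hG.comp measurable_prodMk_left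
  rw [randomMapKernel_apply hG, Measure.map_apply hGx hA]
  rfl

variable [NormedAddCommGroup H] [BorelSpace H] [SecondCountableTopology H]

/-- The noise coordinate is independent of `X` and `Y`, so the bound for frozen arguments can be
integrated by Tonelli. -/
theorem eLpNorm_randomMap_sub_le {γ : Measure Ξ} [IsProbabilityMeasure γ] {G : H × Ξ → H}
    (hG : Measurable G) {K : ℝ≥0}
    (hK : ∀ x y, eLpNorm (fun ξ => G (x, ξ) - G (y, ξ)) 2 γ ≤ K * ‖x - y‖ₑ)
    {Ω : Type*} {mΩ : MeasurableSpace Ω} {μ : Measure Ω} [SFinite μ] {X Y : Ω → H}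
    (hX : Measurable X) (hY : Measurable Y) :
    eLpNorm (fun p : Ω × Ξ => G (X p.1, p.2) - G (Y p.1, p.2)) 2 (μ.prod γ) ≤
      K * eLpNorm (X - Y) 2 μ := by
  refine (ENNReal.pow_le_pow_left_iff (n := 2) (by norm_num)).1 ?_
  have hm : ∀ {Z : Ω → H}, Measurable Z → Measurable fun p : Ω × Ξ => G (Z p.1, p.2) :=
    fun hZ => hG.comp ((hZ.comp measurable_fst).prodMk measurable_snd)
  have hsub : Measurable fun p : Ω × Ξ => G (X p.1, p.2) - G (Y p.1, p.2) :=
    (hm hX).sub (hm hY)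
  rw [mul_pow, eLpNorm_two_pow_two, eLpNorm_two_pow_two,
    lintegral_prod _ (hsub.enorm.pow_const 2).aemeasurable,
    ← lintegral_const_mul _ ((hX.sub hY).enorm.pow_const 2)]
  refine lintegral_mono fun ω => ?_
  rw [← eLpNorm_two_pow_two (fun ξ => G (X ω, ξ) - G (Y ω, ξ)), ← mul_pow]
  gcongr
  exact hK _ _

theorem memLp_randomMap {γ : Measure Ξ} [IsProbabilityMeasure γ] {G : H × Ξ → H}
    (hG : Measurable G) {K : ℝ≥0}
    (hK : ∀ x y, eLpNorm (fun ξ => G (x, ξ) - G (y, ξ)) 2 γ ≤ K * ‖x - y‖ₑ)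
    (h0 : MemLp (fun ξ => G (0, ξ)) 2 γ)
    {Ω : Type*} {mΩ : MeasurableSpace Ω} {μ : Measure Ω} [IsProbabilityMeasure μ] {X : Ω → H}
    (hX : Measurable X) (hX2 : MemLp X 2 μ) :
    MemLp (fun p : Ω × Ξ => G (X p.1, p.2)) 2 (μ.prod γ) := by
  have hgm : ∀ {Z : Ω → H}, Measurable Z → Measurable fun p : Ω × Ξ => G (Z p.1, p.2) :=
    fun hZ => hG.comp ((hZ.comp measurable_fst).prodMk measurable_snd)
  have hmem0 : MemLp (fun p : Ω × Ξ => G (0, p.2)) 2 (μ.prod γ) :=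
    h0.comp_measurePreserving measurePreserving_snd
  have h1 : MemLp (fun p : Ω × Ξ => G (X p.1, p.2) - G (0, p.2)) 2 (μ.prod γ) := by
    refine ⟨((hgm hX).sub (hgm measurable_const)).aestronglyMeasurable, ?_⟩
    refine (eLpNorm_randomMap_sub_le hG hK hX (measurable_const (a := (0 : H)))).trans_lt ?_
    refine ENNReal.mul_lt_top ENNReal.coe_lt_top ?_
    have : (X - (fun _ => (0 : H))) = X := by ext; simp
    rw [this]
    exact hX2.2
  exact (h1.add hmem0).congr_norm (hgm hX).aestronglyMeasurable (ae_of_all _ fun p => by simp)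

/-- A random map that contracts in mean square has an invariant law. -/
theorem exists_invariant_randomMapKernel [CompleteSpace H] {γ : Measure Ξ}
    [IsProbabilityMeasure γ] {G : H × Ξ → H} (hG : Measurable G) {K : ℝ≥0} (hK1 : K < 1)
    (hK : ∀ x y, eLpNorm (fun ξ => G (x, ξ) - G (y, ξ)) 2 γ ≤ K * ‖x - y‖ₑ)
    (h0 : MemLp (fun ξ => G (0, ξ)) 2 γ) :
    ∃ π : ProbabilityMeasure H, (randomMapKernel γ G).Invariant (π : Measure H) := by
  set μ : Measure (ℕ → Ξ) := Measure.infinitePi fun _ : ℕ => γ with hμ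
  set Ψ : (ℕ → Ξ) → (ℕ → Ξ) × Ξ := fun θ => ((fun n => θ (n + 1)), θ 0) with hΨ
  have hΨm : MeasurePreserving Ψ μ (μ.prod γ) := measurePreserving_shift_prodMk_zero γ
  have hXm : ∀ X : Lp H 2 μ, Measurable X := fun X => (Lp.stronglyMeasurable X).measurable
  have hgm : ∀ {Z : (ℕ → Ξ) → H}, Measurable Z →
      Measurable fun p : (ℕ → Ξ) × Ξ => G (Z p.1, p.2) :=
    fun hZ => hG.comp ((hZ.comp measurable_fst).prodMk measurable_snd)
  have hmem : ∀ X : Lp H 2 μ, MemLp (fun p : (ℕ → Ξ) × Ξ => G (X p.1, p.2)) 2 (μ.prod γ) :=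
    fun X => memLp_randomMap hG hK h0 (hXm X) (Lp.memLp X)
  -- The stationary solution is sought as a function of the whole noise history, with `θ 0` the
  -- latest noise: `T X θ = G (X (shift θ), θ 0)`. The shifted history is independent of `θ 0` and
  -- again has law `μ`, so a fixed point of `T` has an invariant law.
  set T : Lp H 2 μ → Lp H 2 μ := fun X => ((hmem X).comp_measurePreserving hΨm).toLp _ with hT
  have hcontr : ContractingWith K T := by
    refine ⟨hK1, fun X Y => ?_⟩
    simp only [hT]
    rw [Lp.edist_toLp_toLp, Lp.edist_def]
    refine le_trans (le_of_eq ?_) (eLpNorm_randomMap_sub_le hG hK (hXm X) (hXm Y))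
    exact eLpNorm_comp_measurePreserving
      ((hgm (hXm X)).sub (hgm (hXm Y))).aestronglyMeasurable hΨm
  obtain ⟨X, hX⟩ : ∃ X, T X = X := ⟨_, hcontr.fixedPoint_isFixedPt⟩
  refine ⟨⟨μ.map X, Measure.isProbabilityMeasure_map (hXm X).aemeasurable⟩, ?_⟩
  change (μ.map X).bind _ = μ.map X
  rw [bind_randomMapKernel hG]
  have h1 : (μ.map X).prod γ = (μ.prod γ).map (Prod.map X id) := by
    conv_lhs => rw [← Measure.map_id (μ := γ)]
    exact Measure.map_prod_map _ _ (hXm X) measurable_id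
  rw [h1, Measure.map_map hG (by have := hXm X; fun_prop), ← hΨm.map_eq,
    Measure.map_map (hG.comp (by have := hXm X; fun_prop)) hΨm.measurable]
  refine Measure.map_congr ?_
  have h2 := ((hmem X).comp_measurePreserving hΨm).coeFn_toLp
  have h3 : (((hmem X).comp_measurePreserving hΨm).toLp _ : Lp H 2 μ) = X := hX
  rw [h3] at h2
  exact h2.symm

/-- Take for `g` the `n`-fold image of `f` under the transition operator. Each application keeps the
sup bound and the integral against invariant laws, and costs a factor `K` in the Lipschitz constant
since the `L¹` norm is at most the `L²` norm. -/
theorem exists_lipschitz_integral_eq_of_invariant {γ : Measure Ξ}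
    [IsProbabilityMeasure γ] {G : H × Ξ → H} (hG : Measurable G) {K : ℝ≥0}
    (hK : ∀ x y, eLpNorm (fun ξ => G (x, ξ) - G (y, ξ)) 2 γ ≤ K * ‖x - y‖ₑ) {C : ℝ} {L : ℝ≥0}
    {f : H → ℝ} (hfC : ∀ x, ‖f x‖ ≤ C) (hfL : LipschitzWith L f) (n : ℕ) :
    ∃ g : H → ℝ, (∀ x, ‖g x‖ ≤ C) ∧ LipschitzWith (K ^ n * L) g ∧
      ∀ π : ProbabilityMeasure H, (randomMapKernel γ G).Invariant (π : Measure H) →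
        ∫ x, g x ∂(π : Measure H) = ∫ x, f x ∂(π : Measure H) := by
  induction n with
  | zero => exact ⟨f, hfC, by simpa using hfL, fun _ _ => rfl⟩
  | succ n ih =>
    obtain ⟨g, hgC, hgL, hgπ⟩ := ih
    have hgm : Measurable g := hgL.continuous.measurable
    have hGx : ∀ x, Measurable fun ξ => G (x, ξ) := fun x => hG.comp measurable_prodMk_left
    have hint : ∀ x, Integrable (fun ξ => g (G (x, ξ))) γ := fun x =>
      Integrable.of_bound (hgm.comp (hGx x)).aestronglyMeasurable C (ae_of_all _ fun _ => hgC _)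
    refine ⟨fun x => ∫ ξ, g (G (x, ξ)) ∂γ, fun x => ?_, fun x y => ?_, fun π hπ => ?_⟩
    · refine (norm_integral_le_of_norm_le_const (ae_of_all _ fun ξ => hgC _)).trans ?_
      simp
    · rw [edist_eq_enorm_sub, ← integral_sub (hint x) (hint y)]
      refine (enorm_integral_le_lintegral_enorm _).trans ?_
      have h1 : ∀ ξ, ‖g (G (x, ξ)) - g (G (y, ξ))‖ₑ ≤
          ((K ^ n * L : ℝ≥0) : ENNReal) * ‖G (x, ξ) - G (y, ξ)‖ₑ := fun ξ => by
        rw [← edist_eq_enorm_sub, ← edist_eq_enorm_sub]; exact hgL _ _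
      refine (lintegral_mono h1).trans ?_
      have hsub : Measurable fun ξ => G (x, ξ) - G (y, ξ) := (hGx x).sub (hGx y)
      rw [lintegral_const_mul _ hsub.enorm, ← eLpNorm_one_eq_lintegral_enorm]
      have h2 : eLpNorm (fun ξ => G (x, ξ) - G (y, ξ)) 1 γ ≤ K * ‖x - y‖ₑ :=
        (eLpNorm_le_eLpNorm_of_exponent_le (by norm_num)
          ((hGx x).sub (hGx y)).aestronglyMeasurable).trans (hK x y)
      refine (mul_le_mul_right h2 _).trans (le_of_eq ?_)
      rw [edist_eq_enorm_sub, ← mul_assoc, ← ENNReal.coe_mul]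
      congr 2; ring
    · rw [← hgπ π hπ]
      have h1 : ((π : Measure H).prod γ).map G = π := by
        rw [← bind_randomMapKernel hG]; exact hπ
      conv_rhs => rw [← h1]
      rw [integral_map hG.aemeasurable hgm.aestronglyMeasurable, integral_prod]
      exact Integrable.of_bound (hgm.comp hG).aestronglyMeasurable C (ae_of_all _ fun _ => hgC _)

/-- A random map that contracts in mean square has at most one invariant law. -/
theorem invariant_randomMapKernel_unique {γ : Measure Ξ}
    [IsProbabilityMeasure γ] {G : H × Ξ → H} (hG : Measurable G) {K : ℝ≥0} (hK1 : K < 1)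
    (hK : ∀ x y, eLpNorm (fun ξ => G (x, ξ) - G (y, ξ)) 2 γ ≤ K * ‖x - y‖ₑ)
    {π π' : ProbabilityMeasure H} (hπ : (randomMapKernel γ G).Invariant (π : Measure H))
    (hπ' : (randomMapKernel γ G).Invariant (π' : Measure H)) : π = π' := by
  -- Equality is obtained as convergence of a constant sequence, because weak convergence can be
  -- tested on bounded Lipschitz functions.
  have key : Tendsto (fun _ : ℕ => π) atTop (𝓝 π') := by
    rw [tendsto_iff_forall_lipschitz_integral_tendsto]
    rintro f ⟨C, hC⟩ ⟨L, hL⟩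
    have hfC : ∀ x, ‖f x‖ ≤ C + ‖f 0‖ := fun x => by
      have := hC x 0
      rw [dist_eq_norm] at this
      have h2 := norm_add_le (f x - f 0) (f 0)
      rw [sub_add_cancel] at h2
      linarith
    choose g hgC hgL hgπ using
      exists_lipschitz_integral_eq_of_invariant hG hK hfC hL
    have hlim : ∀ x, Tendsto (fun n => g n x - g n 0) atTop (𝓝 0) := by
      intro x
      refine squeeze_zero_norm (a := fun n => (K : ℝ) ^ n * (L * ‖x‖)) (fun n => ?_) ?_
      · have := (hgL n).dist_le_mul x 0
        rw [dist_eq_norm, dist_zero_right] at this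
        refine this.trans (le_of_eq ?_)
        push_cast; ring
      · have := (tendsto_pow_atTop_nhds_zero_of_lt_one K.coe_nonneg
          (NNReal.coe_lt_one.2 hK1)).mul_const ((L : ℝ) * ‖x‖)
        rwa [zero_mul] at this
    have hgi : ∀ n (ν : ProbabilityMeasure H), Integrable (g n) (ν : Measure H) := fun n ν =>
      Integrable.of_bound (hgL n).continuous.measurable.aestronglyMeasurable _
        (ae_of_all _ (hgC n))
    -- The numbers `g n 0` do not depend on `ν` and converge to the `ν`-integral of `f` for every
    -- invariant `ν`, so all these integrals agree.
    have hint : ∀ ν : ProbabilityMeasure H, (randomMapKernel γ G).Invariant (ν : Measure H) →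
        Tendsto (fun n => ∫ x, f x ∂(ν : Measure H) - g n 0) atTop (𝓝 0) := by
      intro ν hν
      have h1 : ∀ n, ∫ x, f x ∂(ν : Measure H) - g n 0 = ∫ x, (g n x - g n 0) ∂(ν : Measure H) := by
        intro n
        rw [integral_sub (hgi n ν) (integrable_const _), hgπ n ν hν]; simp
      simp_rw [h1]
      rw [← integral_zero H ℝ (μ := (ν : Measure H))]
      refine tendsto_integral_of_dominated_convergence (fun _ => 2 * (C + ‖f 0‖))
        (fun n => ((hgi n ν).sub (integrable_const _)).aestronglyMeasurable)
        (integrable_const _) (fun n => ae_of_all _ fun x => ?_) (ae_of_all _ hlim)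
      refine (norm_sub_le _ _).trans ?_
      linarith [hgC n x, hgC n 0]
    have h2 := (hint π hπ).sub (hint π' hπ')
    simp only [sub_sub_sub_cancel_right, sub_zero] at h2
    have h3 := tendsto_nhds_unique tendsto_const_nhds h2
    rw [sub_eq_zero.1 h3]
    exact tendsto_const_nhds
  exact tendsto_nhds_unique tendsto_const_nhds key

end RandomMap

/-! ### Gaussian series and the Itô isometry -/

section GaussianSeries

/-- The law of a sequence of independent centered Gaussian variables of variance `v`. -/
noncomputable abbrev gaussianSeq (v : ℝ≥0) : Measure (ℕ → ℝ) :=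
  Measure.infinitePi fun _ : ℕ => gaussianReal 0 v

theorem memLp_eval_gaussianSeq (v : ℝ≥0) (i : ℕ) :
    MemLp (fun ξ : ℕ → ℝ => ξ i) 2 (gaussianSeq v) :=
  (memLp_id_gaussianReal' (μ := 0) (v := v) 2 (by norm_num)).comp_measurePreserving
    (measurePreserving_eval_infinitePi (fun _ : ℕ => gaussianReal 0 v) i)

theorem integral_eval_gaussianSeq (v : ℝ≥0) (i : ℕ) : ∫ ξ, ξ i ∂gaussianSeq v = 0 := by
  have h := measurePreserving_eval_infinitePi (fun _ : ℕ => gaussianReal 0 v) i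
  rw [← integral_id_gaussianReal (μ := 0) (v := v), ← h.map_eq,
    integral_map h.measurable.aemeasurable (by fun_prop)]

theorem integral_eval_mul_eval_gaussianSeq (v : ℝ≥0) (i j : ℕ) :
    ∫ ξ, ξ i * ξ j ∂gaussianSeq v = if i = j then (v : ℝ) else 0 := by
  split_ifs with hij
  · subst hij
    have h := measurePreserving_eval_infinitePi (fun _ : ℕ => gaussianReal 0 v) i
    have h1 : ∫ x, x * x ∂gaussianReal 0 v = v := by
      have h2 := variance_of_integral_eq_zero (X := id) (μ := gaussianReal 0 v)
        measurable_id.aemeasurable (by simp)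
      rw [variance_id_gaussianReal] at h2
      rw [h2]
      exact integral_congr_ae (ae_of_all _ fun x => by simp [sq])
    rw [← h1, ← h.map_eq, integral_map h.measurable.aemeasurable (by fun_prop)]
  · have h := (iIndepFun_infinitePi (P := fun _ : ℕ => gaussianReal 0 v)
      (X := fun _ x => x) (fun _ => measurable_id)).indepFun hij
    rw [h.integral_fun_mul_eq_mul_integral (measurable_pi_apply i).aestronglyMeasurable
        (measurable_pi_apply j).aestronglyMeasurable,
      integral_eval_gaussianSeq, zero_mul]

theorem enorm_sq_eq_ofReal {E : Type*} [NormedAddCommGroup E] (x : E) :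
    ‖x‖ₑ ^ 2 = ENNReal.ofReal (‖x‖ ^ 2) := by
  rw [ENNReal.ofReal_pow (norm_nonneg _), ofReal_norm]

/-- The rate `4⁻¹ ^ k` for squared tails means `2⁻¹ ^ k` in `L²`, which is summable and gives almost
sure convergence along these indices; `k ≤ n` sends them to infinity. -/
theorem exists_tail_le {X E : Type*} [NormedAddCommGroup E] {b : ℕ → X → E}
    (hb : ∀ x, ∑' j, ‖b j x‖ₑ ^ 2 ≠ ⊤) (k : ℕ) (x : X) :
    ∃ n, k ≤ n ∧ ∑' j, ‖b (j + n) x‖ₑ ^ 2 ≤ (4⁻¹ : ENNReal) ^ k := by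
  have h1 := ENNReal.tendsto_sum_nat_add (fun j => ‖b j x‖ₑ ^ 2) (hb x)
  have h2 : (0 : ENNReal) < 4⁻¹ ^ k := ENNReal.pow_pos (by simp) _
  obtain ⟨n, hn1, hn2⟩ := ((h1.eventually_lt_const h2).and (eventually_ge_atTop k)).exists
  exact ⟨n, hn2, hn1.le⟩

variable {H : Type*} [NormedAddCommGroup H] [InnerProductSpace ℝ H]

/-- The coordinates are centred and uncorrelated with variance `v`, so all cross terms, including
those with the shift `a`, integrate to zero. -/
theorem eLpNorm_add_sum_gaussianSeq_sq (v : ℝ≥0) (a : H) (s : Finset ℕ) (c : ℕ → H) :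
    eLpNorm (fun ξ : ℕ → ℝ => a + ∑ j ∈ s, ξ j • c j) 2 (gaussianSeq v) ^ 2 =
      ‖a‖ₑ ^ 2 + v * ∑ j ∈ s, ‖c j‖ₑ ^ 2 := by
  have e1 : ∀ ξ : ℕ → ℝ, ‖a + ∑ j ∈ s, ξ j • c j‖ ^ 2 = ‖a‖ ^ 2 +
      (∑ j ∈ s, ξ j * (2 * inner ℝ a (c j)) +
        ∑ i ∈ s, ∑ j ∈ s, ξ i * ξ j * inner ℝ (c i) (c j)) := by
    intro ξ
    rw [norm_add_sq_real, inner_sum, ← real_inner_self_eq_norm_sq (∑ j ∈ s, ξ j • c j), sum_inner,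
      Finset.mul_sum, add_assoc]
    congr 2
    · exact Finset.sum_congr rfl fun j _ => by rw [real_inner_smul_right]; ring
    · refine Finset.sum_congr rfl fun i _ => ?_
      rw [inner_sum]
      exact Finset.sum_congr rfl fun j _ => by
        rw [real_inner_smul_left, real_inner_smul_right]; ring
  have i1 : ∀ j, Integrable (fun ξ : ℕ → ℝ => ξ j * (2 * inner ℝ a (c j))) (gaussianSeq v) :=
    fun j => ((memLp_eval_gaussianSeq v j).integrable (by norm_num)).mul_const _
  have i2 : ∀ i j, Integrable (fun ξ : ℕ → ℝ => ξ i * ξ j * inner ℝ (c i) (c j))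
      (gaussianSeq v) := fun i j =>
    ((memLp_eval_gaussianSeq v i).integrable_mul (memLp_eval_gaussianSeq v j)).mul_const _
  have i3 : Integrable (fun ξ : ℕ → ℝ => ∑ j ∈ s, ξ j * (2 * inner ℝ a (c j))) (gaussianSeq v) :=
    integrable_finsetSum _ fun j _ => i1 j
  have i4 : Integrable (fun ξ : ℕ → ℝ => ∑ i ∈ s, ∑ j ∈ s, ξ i * ξ j * inner ℝ (c i) (c j))
      (gaussianSeq v) := integrable_finsetSum _ fun i _ => integrable_finsetSum _ fun j _ => i2 i j
  have hval : ∫ ξ, ‖a + ∑ j ∈ s, ξ j • c j‖ ^ 2 ∂gaussianSeq v =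
      ‖a‖ ^ 2 + v * ∑ j ∈ s, ‖c j‖ ^ 2 := by
    simp_rw [e1]
    have i34 : Integrable (fun ξ : ℕ → ℝ => ∑ j ∈ s, ξ j * (2 * inner ℝ a (c j)) +
        ∑ i ∈ s, ∑ j ∈ s, ξ i * ξ j * inner ℝ (c i) (c j)) (gaussianSeq v) := i3.add i4
    rw [integral_add (integrable_const _) i34, integral_add i3 i4,
      integral_finsetSum _ fun j _ => i1 j,
      integral_finsetSum _ fun i _ => integrable_finsetSum _ fun j _ => i2 i j]
    simp_rw [integral_finsetSum s fun j _ => i2 _ j, integral_mul_const,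
      integral_eval_gaussianSeq, integral_eval_mul_eval_gaussianSeq]
    simp [Finset.mul_sum]
  have hint : Integrable (fun ξ : ℕ → ℝ => ‖a + ∑ j ∈ s, ξ j • c j‖ ^ 2) (gaussianSeq v) := by
    simp_rw [e1]
    exact (integrable_const _).add (i3.add i4)
  rw [eLpNorm_two_pow_two]
  simp_rw [enorm_sq_eq_ofReal]
  rw [← ofReal_integral_eq_lintegral_ofReal hint (ae_of_all _ fun _ => by positivity), hval,
    ENNReal.ofReal_add (by positivity) (by positivity), ENNReal.ofReal_mul v.coe_nonneg,
    ENNReal.ofReal_coe_nnreal, ENNReal.ofReal_sum_of_nonneg fun _ _ => by positivity]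

theorem eLpNorm_sum_sub_sum_gaussianSeq_sq_le (v : ℝ≥0) (c : ℕ → H) {N n m : ℕ} (hn : N ≤ n)
    (hm : N ≤ m) :
    eLpNorm (fun ξ : ℕ → ℝ => ∑ j ∈ Finset.range n, ξ j • c j -
      ∑ j ∈ Finset.range m, ξ j • c j) 2 (gaussianSeq v) ^ 2 ≤
      v * ∑' j, ‖c (j + N)‖ₑ ^ 2 := by
  wlog h : m ≤ n generalizing n m
  · refine le_trans (le_of_eq ?_) (this hm hn (le_of_not_ge h))
    congr 1
    rw [← eLpNorm_neg]
    congr 1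
    ext ξ; simp
  have e1 : (fun ξ : ℕ → ℝ => ∑ j ∈ Finset.range n, ξ j • c j - ∑ j ∈ Finset.range m, ξ j • c j) =
      fun ξ => 0 + ∑ j ∈ Finset.Ico m n, ξ j • c j := by
    ext ξ; rw [Finset.sum_Ico_eq_sub _ h, zero_add]
  rw [e1, eLpNorm_add_sum_gaussianSeq_sq]
  simp only [enorm_zero, ne_eq, OfNat.ofNat_ne_zero, not_false_eq_true, zero_pow, zero_add]
  gcongr
  calc ∑ j ∈ Finset.Ico m n, ‖c j‖ₑ ^ 2 ≤ ∑ j ∈ Finset.Ico N n, ‖c j‖ₑ ^ 2 :=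
        Finset.sum_le_sum_of_subset (Finset.Ico_subset_Ico hm le_rfl)
    _ = ∑ j ∈ Finset.range (n - N), ‖c (j + N)‖ₑ ^ 2 := by
        rw [Finset.sum_Ico_eq_sum_range]
        exact Finset.sum_congr rfl fun j _ => by rw [add_comm]
    _ ≤ _ := ENNReal.sum_le_tsum _

variable [MeasurableSpace H] {b : ℕ → H → H}

open Classical in
/-- The sum of the random series `∑ⱼ ξⱼ bⱼ(x)`, as a function of `x` and `ξ`: the limit along a
subsequence of partial sums chosen measurably in `x`. -/
noncomputable def gaussianSeries (b : ℕ → H → H) (hb : ∀ x, ∑' j, ‖b j x‖ₑ ^ 2 ≠ ⊤)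
    (p : H × (ℕ → ℝ)) : H :=
  limUnder atTop fun k : ℕ =>
    ∑ j ∈ Finset.range (Nat.find (exists_tail_le hb k p.1)), p.2 j • b j p.1

variable [BorelSpace H] [SecondCountableTopology H]

theorem measurable_sum_smul (hbm : ∀ j, Measurable (b j)) (n : ℕ) :
    Measurable fun p : H × (ℕ → ℝ) => ∑ j ∈ Finset.range n, p.2 j • b j p.1 :=
  Finset.measurable_fun_sum _ fun j _ =>
    ((measurable_pi_apply j).comp measurable_snd).smul ((hbm j).comp measurable_fst)

variable [CompleteSpace H]

/-- The index of the partial sum is the first one meeting a measurable condition on `x`. This gives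
joint measurability in `x` and `ξ`, which a separate `L²` limit for each `x` would not provide. -/
theorem measurable_gaussianSeries (hbm : ∀ j, Measurable (b j))
    (hb : ∀ x, ∑' j, ‖b j x‖ₑ ^ 2 ≠ ⊤) : Measurable (gaussianSeries b hb) := by
  classical
  refine (StronglyMeasurable.limUnder fun k => Measurable.stronglyMeasurable ?_).measurable
  have htail : ∀ n, Measurable fun x : H => ∑' j, ‖b (j + n) x‖ₑ ^ 2 := fun n =>
    Measurable.tsum fun j => (hbm _).enorm.pow_const 2
  exact Measurable.find (f := fun n (p : H × (ℕ → ℝ)) => ∑ j ∈ Finset.range n, p.2 j • b j p.1)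
    (p := fun n p => k ≤ n ∧ ∑' j, ‖b (j + n) p.1‖ₑ ^ 2 ≤ (4⁻¹ : ENNReal) ^ k)
    (fun n => measurable_sum_smul hbm n)
    (fun n => (MeasurableSet.const _).inter
      (measurableSet_le ((htail n).comp measurable_fst) measurable_const))
    (fun p => exists_tail_le hb k p.1)

/-- The chosen subsequence converges almost surely, and Fatou's lemma bounds the distance of every
partial sum from the limit by the tail of the coefficients. -/
theorem tendsto_eLpNorm_sum_sub_gaussianSeries (v : ℝ≥0) (hb : ∀ x, ∑' j, ‖b j x‖ₑ ^ 2 ≠ ⊤)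
    (x : H) : Tendsto (fun n => eLpNorm (fun ξ : ℕ → ℝ => ∑ j ∈ Finset.range n, ξ j • b j x -
      gaussianSeries b hb (x, ξ)) 2 (gaussianSeq v)) atTop (𝓝 0) := by
  classical
  set S : ℕ → (ℕ → ℝ) → H := fun n ξ => ∑ j ∈ Finset.range n, ξ j • b j x with hS
  have hSm : ∀ n, AEStronglyMeasurable (S n) (gaussianSeq v) := fun n =>
    (Finset.measurable_fun_sum _ fun j _ =>
      (measurable_pi_apply j).smul_const _).aestronglyMeasurable
  set N : ℕ → ℕ := fun k => Nat.find (exists_tail_le hb k x) with hN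
  have hNk : ∀ k, k ≤ N k := fun k => (Nat.find_spec (exists_tail_le hb k x)).1
  have hNt : ∀ k, ∑' j, ‖b (j + N k) x‖ₑ ^ 2 ≤ (4⁻¹ : ENNReal) ^ k := fun k =>
    (Nat.find_spec (exists_tail_le hb k x)).2
  have hNmono : Monotone N := by
    intro k l hkl
    refine Nat.find_min' _ ⟨hkl.trans (hNk l), (hNt l).trans ?_⟩
    exact pow_le_pow_right_of_le_one' (by simp) hkl
  have hcau : ∀ᵐ ξ ∂gaussianSeq v, ∃ l : H, Tendsto (fun k => S (N k) ξ) atTop (𝓝 l) := by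
    -- The constant `v + 1` satisfies `v < (v + 1)²`, giving the strict inequality even for `v = 0`.
    refine Lp.ae_tendsto_of_cauchy_eLpNorm (p := 2) (B := fun k => (v + 1) * (2⁻¹ : ENNReal) ^ k)
      (fun k => hSm _) (by norm_num) ?_ fun M n m hn hm => ?_
    · rw [ENNReal.tsum_mul_left, ENNReal.tsum_geometric]
      refine ENNReal.mul_ne_top (by simp) (by simp)
    · refine (ENNReal.pow_lt_pow_left_iff (n := 2) (by norm_num)).1 ?_
      refine (eLpNorm_sum_sub_sum_gaussianSeq_sq_le v (fun j => b j x) (hNmono hn)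
        (hNmono hm)).trans_lt ?_
      refine (mul_le_mul_right (hNt M) _).trans_lt ?_
      have h4 : ((2⁻¹ : ENNReal) ^ M) ^ 2 = 4⁻¹ ^ M := by
        rw [← pow_mul, mul_comm, pow_mul, ← ENNReal.inv_pow]; norm_num
      rw [mul_pow, h4]
      refine (ENNReal.mul_lt_mul_iff_left (ENNReal.pow_pos (by simp) _).ne'
        (ENNReal.pow_ne_top (by simp))).2 ?_
      have : v < (v + 1) ^ 2 := by
        rw [← NNReal.coe_lt_coe]; push_cast; nlinarith [v.coe_nonneg]
      exact_mod_cast this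
  have hlim : ∀ᵐ ξ ∂gaussianSeq v,
      Tendsto (fun k => S (N k) ξ) atTop (𝓝 (gaussianSeries b hb (x, ξ))) := by
    filter_upwards [hcau] with ξ hξ
    exact tendsto_nhds_limUnder hξ
  have hbound : ∀ n, eLpNorm (fun ξ => S n ξ - gaussianSeries b hb (x, ξ)) 2 (gaussianSeq v) ^ 2 ≤
      v * ∑' j, ‖b (j + n) x‖ₑ ^ 2 := by
    intro n
    set R : ENNReal := (v * ∑' j, ‖b (j + n) x‖ₑ ^ 2) ^ (1 / 2 : ℝ) with hR
    have hR2 : R ^ 2 = v * ∑' j, ‖b (j + n) x‖ₑ ^ 2 := by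
      rw [hR, ← ENNReal.rpow_natCast, ← ENNReal.rpow_mul]; norm_num
    rw [← hR2]
    gcongr
    refine (Lp.eLpNorm_lim_le_liminf_eLpNorm (f := fun k ξ => S n ξ - S (N k) ξ)
      (fun k => (hSm n).sub (hSm _)) _ (hlim.mono fun ξ hξ => hξ.const_sub _)).trans ?_
    refine liminf_le_of_le (by isBoundedDefault) fun B hB => ?_
    obtain ⟨k, hk1, hk2⟩ := (hB.and (eventually_ge_atTop n)).exists
    refine hk1.trans ((ENNReal.pow_le_pow_left_iff (n := 2) (by norm_num)).1 ?_)
    rw [hR2]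
    exact eLpNorm_sum_sub_sum_gaussianSeq_sq_le v (fun j => b j x) le_rfl (hk2.trans (hNk k))
  have h0 : Tendsto (fun n => (v * ∑' j, ‖b (j + n) x‖ₑ ^ 2 : ENNReal) ^ (1 / 2 : ℝ)) atTop
      (𝓝 0) := by
    have h1 := ENNReal.Tendsto.const_mul (a := (v : ENNReal))
      (ENNReal.tendsto_sum_nat_add (fun j => ‖b j x‖ₑ ^ 2) (hb x)) (Or.inr ENNReal.coe_ne_top)
    have h2 := h1.ennrpow_const (1 / 2 : ℝ)
    simpa using h2
  refine tendsto_of_tendsto_of_tendsto_of_le_of_le tendsto_const_nhds h0 (fun _ => zero_le)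
    fun n => ?_
  refine (ENNReal.pow_le_pow_left_iff (n := 2) (by norm_num)).1 ((hbound n).trans (le_of_eq ?_))
  rw [← ENNReal.rpow_natCast, ← ENNReal.rpow_mul]; norm_num

theorem eLpNorm_gaussianSeries_le (v : ℝ≥0) (hbm : ∀ j, Measurable (b j))
    (hb : ∀ x, ∑' j, ‖b j x‖ₑ ^ 2 ≠ ⊤) (x : H) {R : ENNReal}
    (hR : v * ∑' j, ‖b j x‖ₑ ^ 2 ≤ R ^ 2) :
    eLpNorm (fun ξ => gaussianSeries b hb (x, ξ)) 2 (gaussianSeq v) ≤ R := by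
  have hΦ : AEStronglyMeasurable (fun ξ => gaussianSeries b hb (x, ξ)) (gaussianSeq v) :=
    ((measurable_gaussianSeries hbm hb).comp measurable_prodMk_left).aestronglyMeasurable
  have hSm : ∀ n, AEStronglyMeasurable (fun ξ : ℕ → ℝ => ∑ j ∈ Finset.range n, ξ j • b j x)
      (gaussianSeq v) := fun n =>
    ((measurable_sum_smul hbm n).comp measurable_prodMk_left).aestronglyMeasurable
  have h1 := (tendsto_eLpNorm_sum_sub_gaussianSeries v hb x).const_add R
  rw [add_zero] at h1
  refine ge_of_tendsto' h1 fun n => ?_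
  have h2 : eLpNorm (fun ξ : ℕ → ℝ => ∑ j ∈ Finset.range n, ξ j • b j x) 2 (gaussianSeq v) ≤ R := by
    refine (ENNReal.pow_le_pow_left_iff (n := 2) (by norm_num)).1 (le_trans ?_ hR)
    have h3 := eLpNorm_add_sum_gaussianSeq_sq v (0 : H) (Finset.range n) (fun j => b j x)
    simp only [zero_add, enorm_zero, ne_eq, OfNat.ofNat_ne_zero, not_false_eq_true, zero_pow] at h3
    rw [h3]
    gcongr
    exact ENNReal.sum_le_tsum _
  have h4 := eLpNorm_sub_le (hSm n) ((hSm n).sub hΦ) (p := 2) (by norm_num)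
  have h5 : ((fun ξ : ℕ → ℝ => ∑ j ∈ Finset.range n, ξ j • b j x) -
      ((fun ξ : ℕ → ℝ => ∑ j ∈ Finset.range n, ξ j • b j x) -
        fun ξ => gaussianSeries b hb (x, ξ))) = fun ξ => gaussianSeries b hb (x, ξ) := by
    ext ξ; simp
  rw [h5] at h4
  exact h4.trans (by gcongr; exact le_rfl)

/-- The Itô isometry, as an inequality, for differences. -/
theorem eLpNorm_add_gaussianSeries_sub_le (v : ℝ≥0) (hbm : ∀ j, Measurable (b j))
    (hb : ∀ x, ∑' j, ‖b j x‖ₑ ^ 2 ≠ ⊤) (a x y : H) {R : ENNReal}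
    (hR : ‖a‖ₑ ^ 2 + v * ∑' j, ‖b j x - b j y‖ₑ ^ 2 ≤ R ^ 2) :
    eLpNorm (fun ξ => a + (gaussianSeries b hb (x, ξ) - gaussianSeries b hb (y, ξ))) 2
      (gaussianSeq v) ≤ R := by
  have hΦ : ∀ x, AEStronglyMeasurable (fun ξ => gaussianSeries b hb (x, ξ)) (gaussianSeq v) :=
    fun x => ((measurable_gaussianSeries hbm hb).comp measurable_prodMk_left).aestronglyMeasurable
  set S : ℕ → H → (ℕ → ℝ) → H := fun n x ξ => ∑ j ∈ Finset.range n, ξ j • b j x with hS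
  have hSm : ∀ n x, AEStronglyMeasurable (S n x) (gaussianSeq v) := fun n x =>
    ((measurable_sum_smul hbm n).comp measurable_prodMk_left).aestronglyMeasurable
  -- The isometry holds for partial sums; the triangle inequality adds their errors at `x` and `y`,
  -- which tend to zero.
  have h1 := ((tendsto_eLpNorm_sum_sub_gaussianSeries v hb x).add
    (tendsto_eLpNorm_sum_sub_gaussianSeries v hb y)).const_add R
  rw [add_zero, add_zero] at h1
  refine ge_of_tendsto' h1 fun n => ?_
  have h2 : eLpNorm (fun ξ : ℕ → ℝ => a + (S n x ξ - S n y ξ)) 2 (gaussianSeq v) ≤ R := by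
    refine (ENNReal.pow_le_pow_left_iff (n := 2) (by norm_num)).1 (le_trans ?_ hR)
    have h3 := eLpNorm_add_sum_gaussianSeq_sq v a (Finset.range n) (fun j => b j x - b j y)
    simp only [smul_sub, Finset.sum_sub_distrib] at h3
    rw [h3]
    gcongr
    exact ENNReal.sum_le_tsum _
  have h2m : AEStronglyMeasurable (fun ξ : ℕ → ℝ => a + (S n x ξ - S n y ξ)) (gaussianSeq v) :=
    aestronglyMeasurable_const.add ((hSm n x).sub (hSm n y))
  have h4 := eLpNorm_sub_le h2m (((hSm n x).sub (hΦ x)).sub ((hSm n y).sub (hΦ y))) (p := 2)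
    (by norm_num)
  have h5 := eLpNorm_sub_le ((hSm n x).sub (hΦ x)) ((hSm n y).sub (hΦ y)) (p := 2) (by norm_num)
  have h6 : ((fun ξ : ℕ → ℝ => a + (S n x ξ - S n y ξ)) -
      ((S n x - fun ξ => gaussianSeries b hb (x, ξ)) -
        (S n y - fun ξ => gaussianSeries b hb (y, ξ)))) =
      fun ξ => a + (gaussianSeries b hb (x, ξ) - gaussianSeries b hb (y, ξ)) := by
    ext ξ; simp only [Pi.sub_apply]; abel
  rw [h6] at h4
  exact h4.trans (add_le_add h2 h5)

/-- The law of a pair of independent variables. -/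
theorem map_prodMk_eq_prod_of_indep {Ω : Type*} {m mΩ : MeasurableSpace Ω} {P : Measure Ω}
    [IsProbabilityMeasure P] (hm : m ≤ mΩ) {E Ξ : Type*}
    [MeasurableSpace E] [MeasurableSpace Ξ] {w : Ω → E} (hw : Measurable[m] w) {ξ : Ω → Ξ}
    (hξ : Measurable ξ) (hind : Indep (MeasurableSpace.comap ξ inferInstance) m P) :
    P.map (fun ω => (w ω, ξ ω)) = (P.map w).prod (P.map ξ) := by
  have h : IndepFun w ξ P := by
    rw [IndepFun_iff_Indep]
    exact (indep_of_indep_of_le_right hind hw.comap_le).symm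
  exact (indepFun_iff_map_prod_eq_prod_map_map (hw.mono hm le_rfl).aemeasurable
    hξ.aemeasurable).1 h

/-- Convergence in probability of the series with coefficients depending on an independent
variable. -/
theorem tendstoInMeasure_sum_gaussianSeries {Ω : Type*} {mΩ : MeasurableSpace Ω} {P : Measure Ω}
    [IsProbabilityMeasure P] (v : ℝ≥0) (hbm : ∀ j, Measurable (b j))
    (hb : ∀ x, ∑' j, ‖b j x‖ₑ ^ 2 ≠ ⊤) {w : Ω → H} {ξ : Ω → ℕ → ℝ} (hw : Measurable w)
    (hξ : Measurable ξ) (hlaw : P.map (fun ω => (w ω, ξ ω)) = (P.map w).prod (gaussianSeq v)) :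
    TendstoInMeasure P (fun n ω => ∑ j ∈ Finset.range n, ξ ω j • b j (w ω)) atTop
      (fun ω => gaussianSeries b hb (w ω, ξ ω)) := by
  have hΦ := measurable_gaussianSeries hbm hb
  have : IsProbabilityMeasure (P.map w) := Measure.isProbabilityMeasure_map hw.aemeasurable
  intro ε hε
  set A : ℕ → Set (H × (ℕ → ℝ)) := fun n =>
    {p | ε ≤ edist (∑ j ∈ Finset.range n, p.2 j • b j p.1) (gaussianSeries b hb p)} with hA
  have hAm : ∀ n, MeasurableSet (A n) := fun n =>
    measurableSet_le measurable_const ((measurable_sum_smul hbm n).edist hΦ)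
  have h1 : ∀ n, P {ω | ε ≤ edist (∑ j ∈ Finset.range n, ξ ω j • b j (w ω))
      (gaussianSeries b hb (w ω, ξ ω))} =
      ∫⁻ x, gaussianSeq v (Prod.mk x ⁻¹' A n) ∂(P.map w) := by
    intro n
    rw [← Measure.prod_apply (hAm n), ← hlaw, Measure.map_apply (hw.prodMk hξ) (hAm n)]
    rfl
  simp_rw [h1]
  -- Independence allows `x` to be frozen; for fixed `x`, `L²` convergence gives convergence in
  -- measure, and probabilities are dominated by `1`.
  have h2 : Tendsto (fun n => ∫⁻ x, gaussianSeq v (Prod.mk x ⁻¹' A n) ∂(P.map w)) atTop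
      (𝓝 (∫⁻ _, 0 ∂(P.map w))) := by
    refine tendsto_lintegral_of_dominated_convergence (fun _ => 1)
      (fun n => measurable_measure_prodMk_left (hAm n))
      (fun n => ae_of_all _ fun x => prob_le_one) (by simp) (ae_of_all _ fun x => ?_)
    have h3 := tendstoInMeasure_of_tendsto_eLpNorm (μ := gaussianSeq v) (p := 2) (by norm_num)
      (f := fun n (ξ : ℕ → ℝ) => ∑ j ∈ Finset.range n, ξ j • b j x)
      (g := fun ξ => gaussianSeries b hb (x, ξ))
      (fun n => ((measurable_sum_smul hbm n).comp measurable_prodMk_left).aestronglyMeasurable)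
      ((hΦ.comp measurable_prodMk_left).aestronglyMeasurable)
      (tendsto_eLpNorm_sum_sub_gaussianSeries v hb x)
    exact h3 ε hε
  simpa using h2

end GaussianSeries

/-! ### Noise increments and the Markov property -/

section Scheme

variable {Θ : Set R3}

instance : SecondCountableTopology (EMSpace Θ) := by
  have : Fact ((2 : ENNReal) ≠ ⊤) := ⟨by norm_num⟩
  have : SecondCountableTopology (L2Vec Θ) := Lp.SecondCountableTopology
  infer_instance

/-! ### Hilbert-Schmidt norms -/

section HilbertSchmidt

variable {sqrtQ : L2Scalar Θ →L[ℝ] L2Scalar Θ} {e : HilbertBasis ℕ ℝ (L2Scalar Θ)}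

theorem summable_norm_sub_sq {ι E : Type*} [NormedAddCommGroup E] {f g : ι → E}
    (hf : Summable fun j => ‖f j‖ ^ 2) (hg : Summable fun j => ‖g j‖ ^ 2) :
    Summable fun j => ‖f j - g j‖ ^ 2 := by
  refine Summable.of_nonneg_of_le (fun j => by positivity) (fun j => ?_)
    ((hf.mul_left 2).add (hg.mul_left 2))
  have h1 := norm_sub_le (f j) (g j)
  have h2 : ‖f j - g j‖ ^ 2 ≤ (‖f j‖ + ‖g j‖) ^ 2 := by gcongr
  nlinarith [sq_nonneg (‖f j‖ - ‖g j‖)]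

theorem tsum_enorm_sq_eq_ofReal {ι E : Type*} [NormedAddCommGroup E] {f : ι → E}
    (hf : Summable fun j => ‖f j‖ ^ 2) :
    ∑' j, ‖f j‖ₑ ^ 2 = ENNReal.ofReal (∑' j, ‖f j‖ ^ 2) := by
  rw [ENNReal.ofReal_tsum_of_nonneg (fun _ => by positivity) hf]
  exact tsum_congr fun j => enorm_sq_eq_ofReal _

theorem norm_apply_le_hsNorm {Γ : U0 sqrtQ →ₗ[ℝ] EMSpace Θ}
    (h : Summable fun j => ‖Γ (toU0 sqrtQ (e j))‖ ^ 2) (j : ℕ) :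
    ‖Γ (toU0 sqrtQ (e j))‖ ≤ hsNorm e Γ :=
  Real.le_sqrt_of_sq_le (h.le_tsum j fun _ _ => by positivity)

theorem tsum_enorm_sub_sq_le {Γ Γ' : U0 sqrtQ →ₗ[ℝ] EMSpace Θ} (h : IsHS e Γ) (h' : IsHS e Γ')
    {r : ℝ} (hr : hsNorm e (Γ - Γ') ≤ r) :
    ∑' j, ‖Γ (toU0 sqrtQ (e j)) - Γ' (toU0 sqrtQ (e j))‖ₑ ^ 2 ≤ ENNReal.ofReal r ^ 2 := by
  have hs := summable_norm_sub_sq h.2 h'.2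
  have h0 : 0 ≤ hsNorm e (Γ - Γ') := Real.sqrt_nonneg _
  rw [tsum_enorm_sq_eq_ofReal hs, ← ENNReal.ofReal_pow (h0.trans hr)]
  refine ENNReal.ofReal_le_ofReal ?_
  have h1 : hsNorm e (Γ - Γ') ^ 2 =
      ∑' j, ‖Γ (toU0 sqrtQ (e j)) - Γ' (toU0 sqrtQ (e j))‖ ^ 2 := by
    rw [hsNorm, Real.sq_sqrt (tsum_nonneg fun _ => by positivity)]
    rfl
  rw [← h1]
  gcongr

variable {B : EMSpace Θ → (U0 sqrtQ →ₗ[ℝ] EMSpace Θ)}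

/-- Each column is dominated by the Hilbert–Schmidt norm, hence is Lipschitz in `u`. -/
theorem measurable_apply_of_hsNorm_lipschitz (hHS : ∀ u, IsHS e (B u)) {α : ℝ}
    (hlip : ∀ u v : EMSpace Θ, hsNorm e (B u - B v) ≤ α * ‖u - v‖) (j : ℕ) :
    Measurable fun u => B u (toU0 sqrtQ (e j)) := by
  have h : LipschitzWith α.toNNReal fun u => B u (toU0 sqrtQ (e j)) := by
    refine LipschitzWith.of_dist_le_mul fun u v => ?_
    rw [dist_eq_norm, dist_eq_norm]
    have hs := summable_norm_sub_sq (hHS u).2 (hHS v).2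
    refine (norm_apply_le_hsNorm (Γ := B u - B v) hs j).trans ((hlip u v).trans ?_)
    gcongr
    exact Real.le_coe_toNNReal α
  exact h.continuous.measurable

theorem tsum_enorm_apply_sq_ne_top (hHS : ∀ u, IsHS e (B u)) (u : EMSpace Θ) :
    ∑' j, ‖B u (toU0 sqrtQ (e j))‖ₑ ^ 2 ≠ ⊤ := by
  rw [tsum_enorm_sq_eq_ofReal (hHS u).2]
  exact ENNReal.ofReal_ne_top

end HilbertSchmidt

/-! ### Brownian increments -/

section Increments

variable {Ω : Type*} {mΩ : MeasurableSpace Ω} {P : Measure Ω} {𝓕 : Filtration ℝ≥0 mΩ}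
  {β : ℕ → ℝ≥0 → Ω → ℝ}

theorem StochMaxwell.IsBrownianFamily.measurable_increment (hβ : IsBrownianFamily P 𝓕 β)
    {s t : ℝ≥0} (hst : s ≤ t) : Measurable[𝓕 t] fun ω (j : ℕ) => β j t ω - β j s ω :=
  @measurable_pi_lambda _ _ _ (𝓕 t) _ _ fun j =>
    ((hβ.adapted j t).sub ((hβ.adapted j s).mono (𝓕.mono hst))).measurable

theorem StochMaxwell.IsBrownianFamily.map_increment [IsProbabilityMeasure P]
    (hβ : IsBrownianFamily P 𝓕 β) {s t v : ℝ≥0} (hst : s + v = t) :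
    P.map (fun ω (j : ℕ) => β j t ω - β j s ω) = gaussianSeq v := by
  have hind : iIndepFun (fun j ω => β j t ω - β j s ω) P :=
    hβ.indep.comp (fun _ (f : ℝ≥0 → ℝ) => f t - f s) fun _ => by fun_prop
  have hm : ∀ j, Measurable fun ω => β j t ω - β j s ω := fun j =>
    ((hβ.adapted j t).measurable.mono (𝓕.le t) le_rfl).sub
      ((hβ.adapted j s).measurable.mono (𝓕.le s) le_rfl)
  rw [(iIndepFun_iff_map_fun_eq_infinitePi_map hm).1 hind]
  congr 1
  ext1 j
  have h := ((hβ.brownian j).toIsPreBrownianReal.hasLaw_sub t s).map_eq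
  have h2 : nndist t.1 s.1 = v := by
    rw [← hst]
    ext
    simp
  rw [h2] at h
  exact h

theorem StochMaxwell.IsBrownianFamily.map_prodMk_increment [IsProbabilityMeasure P]
    (hβ : IsBrownianFamily P 𝓕 β) {s t v : ℝ≥0} (hst : s + v = t) {E : Type*}
    [MeasurableSpace E] {w : Ω → E} (hw : Measurable[𝓕 s] w) :
    P.map (fun ω => (w ω, fun j : ℕ => β j t ω - β j s ω)) = (P.map w).prod (gaussianSeq v) := by
  have hle : s ≤ t := hst ▸ le_self_add
  rw [map_prodMk_eq_prod_of_indep (𝓕.le s) hw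
    ((hβ.measurable_increment hle).mono (𝓕.le t) le_rfl) (hβ.indep_past s t hle),
    hβ.map_increment hst]

theorem isNoiseIncrement_gaussianSeries [IsProbabilityMeasure P] (hβ : IsBrownianFamily P 𝓕 β)
    {e : HilbertBasis ℕ ℝ (L2Scalar Θ)} {sqrtQ : L2Scalar Θ →L[ℝ] L2Scalar Θ}
    {B : EMSpace Θ → (U0 sqrtQ →ₗ[ℝ] EMSpace Θ)}
    (hbm : ∀ j, Measurable fun u => B u (toU0 sqrtQ (e j)))
    (hb : ∀ u, ∑' j, ‖B u (toU0 sqrtQ (e j))‖ₑ ^ 2 ≠ ⊤)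
    {s t v : ℝ≥0} (hst : s + v = t) {w : Ω → EMSpace Θ} (hw : StronglyMeasurable[𝓕 s] w) :
    IsNoiseIncrement P β e B s t w
      (fun ω => gaussianSeries (fun j u => B u (toU0 sqrtQ (e j))) hb
        (w ω, fun j => β j t ω - β j s ω)) := by
  have hle : s ≤ t := hst ▸ le_self_add
  have h := tendstoInMeasure_sum_gaussianSeries v hbm hb
    (hw.measurable.mono (𝓕.le s) le_rfl)
    ((hβ.measurable_increment hle).mono (𝓕.le t) le_rfl)
    (hβ.map_prodMk_increment hst hw.measurable)
  simpa only [IsNoiseIncrement, map_sum, map_smul] using h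

end Increments

/-! ### The Markov property -/

/-- A random iteration driven by noise independent of the past is a Markov chain. -/
theorem condExp_indicator_randomMap {Ω : Type*} {m mΩ : MeasurableSpace Ω} {P : Measure Ω}
    [IsProbabilityMeasure P] (hm : m ≤ mΩ) {H Ξ : Type*} [MeasurableSpace H]
    [MeasurableSpace Ξ] {γ : Measure Ξ} [IsProbabilityMeasure γ] {G : H × Ξ → H}
    (hG : Measurable G) {w : Ω → H} (hw : Measurable[m] w) {ξ : Ω → Ξ} (hξ : Measurable ξ)
    (hind : Indep (MeasurableSpace.comap ξ inferInstance) m P) (hlaw : P.map ξ = γ)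
    {A : Set H} (hA : MeasurableSet A) :
    P[Set.indicator ((fun ω => G (w ω, ξ ω)) ⁻¹' A) (fun _ => (1 : ℝ)) | m] =ᵐ[P]
      fun ω => (randomMapKernel γ G (w ω)).real A := by
  have hwm : Measurable w := hw.mono hm le_rfl
  have hpre : MeasurableSet ((fun ω => G (w ω, ξ ω)) ⁻¹' A) := (hG.comp (hwm.prodMk hξ)) hA
  have := isMarkovKernel_randomMapKernel (γ := γ) hG
  have hκm : Measurable fun x => (randomMapKernel γ G x).real A :=
    (Kernel.measurable_coe _ hA).ennreal_toReal
  have hκi : Integrable (fun ω => (randomMapKernel γ G (w ω)).real A) P :=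
    Integrable.of_bound (hκm.comp hwm).aestronglyMeasurable 1 (ae_of_all _ fun ω => by
      rw [Real.norm_of_nonneg measureReal_nonneg]; exact measureReal_le_one)
  refine (ae_eq_condExp_of_forall_setIntegral_eq hm ((integrable_const _).indicator hpre)
    (fun D _ _ => hκi.integrableOn) (fun D hD _ => ?_)
    (hκm.comp hw).aestronglyMeasurable).symm
  have hDm := hm _ hD
  rw [setIntegral_indicator hpre, setIntegral_const, smul_eq_mul, mul_one, measureReal_def]
  classical
  -- The event `D` is carried along as a second `m`-measurable coordinate, so that the joint law of
  -- `(w, 1_D)` and `ξ` is a product and Tonelli applies.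
  have hr : Measurable[m] (D.indicator fun _ => (1 : ℝ)) := measurable_const.indicator hD
  have hwr : Measurable[m] fun ω => (w ω, D.indicator (fun _ => (1 : ℝ)) ω) := hw.prodMk hr
  have hjoint := map_prodMk_eq_prod_of_indep hm hwr hξ hind
  rw [hlaw] at hjoint
  set C : Set ((H × ℝ) × Ξ) := {p | p.1.2 = 1 ∧ G (p.1.1, p.2) ∈ A} with hC
  have hCm : MeasurableSet C := by
    refine MeasurableSet.inter ?_ ?_
    · exact (measurable_snd.comp measurable_fst) (measurableSet_singleton 1)
    · have h : Measurable fun p : (H × ℝ) × Ξ => G (p.1.1, p.2) := hG.comp (by fun_prop)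
      exact h hA
  have h1 : P (D ∩ (fun ω => G (w ω, ξ ω)) ⁻¹' A) =
      P.map (fun ω => ((w ω, D.indicator (fun _ => (1 : ℝ)) ω), ξ ω)) C := by
    rw [Measure.map_apply ((hwr.mono hm le_rfl).prodMk hξ) hCm]
    congr 1
    ext ω
    by_cases hω : ω ∈ D <;> simp [hC, hω]
  have h2 : ∀ q : H × ℝ, γ (Prod.mk q ⁻¹' C) =
      (if q.2 = 1 then randomMapKernel γ G q.1 A else 0) := by
    intro q
    have hGq : Measurable fun ξ => G (q.1, ξ) := hG.comp measurable_prodMk_left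
    split_ifs with hq
    · rw [randomMapKernel_apply hG, Measure.map_apply hGq hA]
      congr 1
      ext ξ; simp [hC, hq]
    · have : Prod.mk q ⁻¹' C = ∅ := by ext ξ; simp [hC, hq]
      rw [this, measure_empty]
  have h3 : P (D ∩ (fun ω => G (w ω, ξ ω)) ⁻¹' A) =
      ∫⁻ ω in D, randomMapKernel γ G (w ω) A ∂P := by
    rw [h1, hjoint, Measure.prod_apply hCm, lintegral_map (measurable_measure_prodMk_left hCm)
      (hwr.mono hm le_rfl), ← lintegral_indicator hDm]
    refine lintegral_congr fun ω => ?_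
    rw [h2]
    by_cases hω : ω ∈ D <;> simp [hω]
  rw [h3]
  exact integral_toReal ((Kernel.measurable_coe _ hA).comp hwm).aemeasurable
    (ae_of_all _ fun ω => measure_lt_top _ _)

end Scheme

/-! ### Mean-square contraction of one step -/

section StepMap

variable {Θ : Set R3} {sqrtQ : L2Scalar Θ →L[ℝ] L2Scalar Θ} {e : HilbertBasis ℕ ℝ (L2Scalar Θ)}
  {B : EMSpace Θ → (U0 sqrtQ →ₗ[ℝ] EMSpace Θ)}

/-- One step of the scheme, for the solution map `S` of the implicit equation. -/
noncomputable def schemeStep (S : EMSpace Θ → EMSpace Θ)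
    (hb : ∀ u, ∑' j, ‖B u (toU0 sqrtQ (e j))‖ₑ ^ 2 ≠ ⊤) (p : EMSpace Θ × (ℕ → ℝ)) : EMSpace Θ :=
  S (p.1 + gaussianSeries (fun j u => B u (toU0 sqrtQ (e j))) hb p)

theorem measurable_schemeStep {S : EMSpace Θ → EMSpace Θ} (hS : Continuous S)
    (hbm : ∀ j, Measurable fun u => B u (toU0 sqrtQ (e j)))
    (hb : ∀ u, ∑' j, ‖B u (toU0 sqrtQ (e j))‖ₑ ^ 2 ≠ ⊤) : Measurable (schemeStep S hb) :=
  hS.measurable.comp (measurable_fst.add (measurable_gaussianSeries hbm hb))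

/-- The Lipschitz bound for `S` reduces this to the Itô isometry for `x - y` plus the difference of
the noise terms. -/
theorem eLpNorm_schemeStep_sub_le {S : EMSpace Θ → EMSpace Θ} {L : ℝ≥0} (hS : LipschitzWith L S)
    (hHS : ∀ u, IsHS e (B u)) (hbm : ∀ j, Measurable fun u => B u (toU0 sqrtQ (e j)))
    (hb : ∀ u, ∑' j, ‖B u (toU0 sqrtQ (e j))‖ₑ ^ 2 ≠ ⊤) {α : ℝ≥0}
    (hlip : ∀ u v : EMSpace Θ, hsNorm e (B u - B v) ≤ α * ‖u - v‖) (τ : ℝ≥0)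
    (x y : EMSpace Θ) :
    eLpNorm (fun ξ => schemeStep S hb (x, ξ) - schemeStep S hb (y, ξ)) 2 (gaussianSeq τ) ≤
      (L * NNReal.sqrt (1 + τ * α ^ 2) : ℝ≥0) * ‖x - y‖ₑ := by
  have h1 : eLpNorm (fun ξ => schemeStep S hb (x, ξ) - schemeStep S hb (y, ξ)) 2 (gaussianSeq τ) ≤
      L • eLpNorm (fun ξ => (x - y) + (gaussianSeries (fun j u => B u (toU0 sqrtQ (e j))) hb (x, ξ) -
        gaussianSeries (fun j u => B u (toU0 sqrtQ (e j))) hb (y, ξ))) 2 (gaussianSeq τ) := by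
    refine eLpNorm_le_nnreal_smul_eLpNorm_of_ae_le_mul (ae_of_all _ fun ξ => ?_) 2
    have h := hS.dist_le_mul (x + gaussianSeries (fun j u => B u (toU0 sqrtQ (e j))) hb (x, ξ))
      (y + gaussianSeries (fun j u => B u (toU0 sqrtQ (e j))) hb (y, ξ))
    rwa [dist_eq_norm, dist_eq_norm, add_sub_add_comm] at h
  refine h1.trans ?_
  rw [ENNReal.smul_def, smul_eq_mul, ENNReal.coe_mul, mul_assoc]
  gcongr
  refine eLpNorm_add_gaussianSeries_sub_le τ hbm hb (x - y) x y ?_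
  have h2 := tsum_enorm_sub_sq_le (hHS x) (hHS y) (hlip x y)
  have h3 : ENNReal.ofReal (α * ‖x - y‖) = α * ‖x - y‖ₑ := by
    rw [ENNReal.ofReal_mul α.coe_nonneg, ENNReal.ofReal_coe_nnreal, ofReal_norm]
  rw [h3] at h2
  calc ‖x - y‖ₑ ^ 2 + τ * ∑' j, ‖B x (toU0 sqrtQ (e j)) - B y (toU0 sqrtQ (e j))‖ₑ ^ 2
      ≤ ‖x - y‖ₑ ^ 2 + τ * (α * ‖x - y‖ₑ) ^ 2 := by gcongr
    _ = ((1 + τ * α ^ 2 : ℝ≥0) : ENNReal) * ‖x - y‖ₑ ^ 2 := by push_cast; ring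
    _ = _ := by
      rw [mul_pow, ← ENNReal.coe_pow, NNReal.sq_sqrt]

theorem memLp_schemeStep_zero {S : EMSpace Θ → EMSpace Θ} {L : ℝ≥0} (hS : LipschitzWith L S)
    (hbm : ∀ j, Measurable fun u => B u (toU0 sqrtQ (e j)))
    (hb : ∀ u, ∑' j, ‖B u (toU0 sqrtQ (e j))‖ₑ ^ 2 ≠ ⊤) (τ : ℝ≥0) :
    MemLp (fun ξ => schemeStep S hb (0, ξ)) 2 (gaussianSeq τ) := by
  have hΦ := measurable_gaussianSeries hbm hb
  have h1 : MemLp (fun ξ => gaussianSeries (fun j u => B u (toU0 sqrtQ (e j))) hb (0, ξ)) 2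
      (gaussianSeq τ) := by
    refine ⟨(hΦ.comp measurable_prodMk_left).aestronglyMeasurable, ?_⟩
    set T : ENNReal := τ * ∑' j, ‖B 0 (toU0 sqrtQ (e j))‖ₑ ^ 2 with hT
    have hTt : T ≠ ⊤ := ENNReal.mul_ne_top ENNReal.coe_ne_top (hb 0)
    refine (eLpNorm_gaussianSeries_le τ hbm hb 0 (R := T ^ (1 / 2 : ℝ)) ?_).trans_lt
      (ENNReal.rpow_lt_top_of_nonneg (by norm_num) hTt)
    rw [← ENNReal.rpow_natCast, ← ENNReal.rpow_mul]; norm_num [hT]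
  have h2 : MemLp (fun ξ => schemeStep S hb (0, ξ) - S 0) 2 (gaussianSeq τ) := by
    refine h1.of_le_mul (c := L) (((measurable_schemeStep hS.continuous hbm hb).comp
      measurable_prodMk_left).sub measurable_const).aestronglyMeasurable (ae_of_all _ fun ξ => ?_)
    have h := hS.norm_sub_le (0 + gaussianSeries (fun j u => B u (toU0 sqrtQ (e j))) hb (0, ξ)) 0
    rw [sub_zero, zero_add] at h
    simpa only [schemeStep, zero_add] using h
  have h3 := h2.add (memLp_const (S 0))
  refine h3.congr_norm ((measurable_schemeStep hS.continuous hbm hb).comp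
      measurable_prodMk_left).aestronglyMeasurable (ae_of_all _ fun ξ => by simp)

/-- Indeed `1 + τα² ≤ 1 + 2τα² < 1 + τa ≤ (1 + τa)²`; no smallness of `τ` is needed. -/
theorem contraction_factor_lt_one {a α τ : ℝ≥0} (hτ : 0 < τ) (ha : 2 * (α : ℝ) ^ 2 < a) :
    (1 + τ * a)⁻¹ * NNReal.sqrt (1 + τ * α ^ 2) < 1 := by
  rw [inv_mul_lt_iff₀ (by positivity), mul_one, ← NNReal.sqrt_sq (1 + τ * a), NNReal.sqrt_lt_sqrt,
    ← NNReal.coe_lt_coe]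
  push_cast
  have h1 : (0 : ℝ) < τ := hτ
  have h2 : (τ : ℝ) * (2 * (α : ℝ) ^ 2) < τ * a := by gcongr
  have h3 : 0 ≤ (τ : ℝ) * (α : ℝ) ^ 2 := by positivity
  nlinarith [sq_nonneg ((τ : ℝ) * a)]

end StepMap

/-! ### Well-posedness and the transition kernel -/

section WellPosed

variable {Θ : Set R3} {Ω : Type*} {mΩ : MeasurableSpace Ω} {P : Measure Ω}
  [IsProbabilityMeasure P] {𝓕 : Filtration ℝ≥0 mΩ} {β : ℕ → ℝ≥0 → Ω → ℝ}
  {sqrtQ : L2Scalar Θ →L[ℝ] L2Scalar Θ} {e : HilbertBasis ℕ ℝ (L2Scalar Θ)}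
  {B : EMSpace Θ → (U0 sqrtQ →ₗ[ℝ] EMSpace Θ)} {F : EMSpace Θ → EMSpace Θ}
  {S : EMSpace Θ → EMSpace Θ} {σ : ℝ} {τ : ℝ≥0}

/-- The numerical solution generated by the step map. -/
noncomputable def schemeIterate (β : ℕ → ℝ≥0 → Ω → ℝ) (S : EMSpace Θ → EMSpace Θ)
    (hb : ∀ u, ∑' j, ‖B u (toU0 sqrtQ (e j))‖ₑ ^ 2 ≠ ⊤) (τ : ℝ≥0) (u₀ : Ω → EMSpace Θ) :
    ℕ → Ω → EMSpace Θ
  | 0 => u₀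
  | k + 1 => fun ω => schemeStep S hb (schemeIterate β S hb τ u₀ k ω,
      fun j => β j ((k + 1 : ℕ) * τ) ω - β j (k * τ) ω)

theorem natCast_mul_add_eq (τ : ℝ≥0) (k : ℕ) : (k : ℝ≥0) * τ + τ = ((k + 1 : ℕ) : ℝ≥0) * τ := by
  push_cast; ring

theorem natCast_mul_le_succ (τ : ℝ≥0) (k : ℕ) : (k : ℝ≥0) * τ ≤ ((k + 1 : ℕ) : ℝ≥0) * τ :=
  (natCast_mul_add_eq τ k) ▸ le_self_add

omit [IsProbabilityMeasure P] in
theorem stronglyMeasurable_schemeIterate (hβ : IsBrownianFamily P 𝓕 β) (hS : Continuous S)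
    (hbm : ∀ j, Measurable fun u => B u (toU0 sqrtQ (e j)))
    (hb : ∀ u, ∑' j, ‖B u (toU0 sqrtQ (e j))‖ₑ ^ 2 ≠ ⊤) {u₀ : Ω → EMSpace Θ}
    (hu₀ : StronglyMeasurable[𝓕 0] u₀) (k : ℕ) :
    StronglyMeasurable[𝓕 (k * τ)] (schemeIterate β S hb τ u₀ k) := by
  induction k with
  | zero => rw [Nat.cast_zero, zero_mul]; exact hu₀
  | succ k ih =>
    have h1 : Measurable[𝓕 ((k + 1 : ℕ) * τ)] (schemeIterate β S hb τ u₀ k) :=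
      ih.measurable.mono (𝓕.mono (natCast_mul_le_succ τ k)) le_rfl
    have h2 := hβ.measurable_increment (natCast_mul_le_succ τ k)
    exact ((measurable_schemeStep hS hbm hb).comp (h1.prodMk h2)).stronglyMeasurable

theorem memLp_schemeIterate (hβ : IsBrownianFamily P 𝓕 β) (hS : Continuous S)
    (hbm : ∀ j, Measurable fun u => B u (toU0 sqrtQ (e j)))
    (hb : ∀ u, ∑' j, ‖B u (toU0 sqrtQ (e j))‖ₑ ^ 2 ≠ ⊤) {K : ℝ≥0}
    (hK : ∀ x y, eLpNorm (fun ξ => schemeStep S hb (x, ξ) - schemeStep S hb (y, ξ)) 2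
      (gaussianSeq τ) ≤ K * ‖x - y‖ₑ)
    (h0 : MemLp (fun ξ => schemeStep S hb (0, ξ)) 2 (gaussianSeq τ)) {u₀ : Ω → EMSpace Θ}
    (hu₀ : StronglyMeasurable[𝓕 0] u₀) (hu₀2 : MemLp u₀ 2 P) (k : ℕ) :
    MemLp (schemeIterate β S hb τ u₀ k) 2 P := by
  induction k with
  | zero => exact hu₀2
  | succ k ih =>
    have hw := (stronglyMeasurable_schemeIterate (τ := τ) hβ hS hbm hb hu₀ k).measurable
    have hwm : Measurable (schemeIterate β S hb τ u₀ k) := hw.mono (𝓕.le _) le_rfl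
    have hG := measurable_schemeStep hS hbm hb
    have hlaw := hβ.map_prodMk_increment (natCast_mul_add_eq τ k) hw
    have : IsProbabilityMeasure (P.map (schemeIterate β S hb τ u₀ k)) :=
      Measure.isProbabilityMeasure_map hwm.aemeasurable
    have h1 := memLp_randomMap hG hK h0 (μ := P.map (schemeIterate β S hb τ u₀ k)) measurable_id
      ((memLp_map_measure_iff aestronglyMeasurable_id hwm.aemeasurable).2 ih)
    rw [← hlaw] at h1
    have hξ := (hβ.measurable_increment (natCast_mul_le_succ τ k)).mono (𝓕.le _) le_rfl
    exact (memLp_map_measure_iff h1.1 (hwm.prodMk hξ).aemeasurable).1 h1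

theorem isNumericalSolution_schemeIterate (hβ : IsBrownianFamily P 𝓕 β) (hS : Continuous S)
    (hSs : ∀ f, ∃ z, IsMaxwell Θ (S f) z ∧
      S f - f = (τ : ℝ) • z - (σ * τ) • S f + (τ : ℝ) • F (S f))
    (hbm : ∀ j, Measurable fun u => B u (toU0 sqrtQ (e j)))
    (hb : ∀ u, ∑' j, ‖B u (toU0 sqrtQ (e j))‖ₑ ^ 2 ≠ ⊤) {u₀ : Ω → EMSpace Θ}
    (hu₀ : StronglyMeasurable[𝓕 0] u₀) :
    IsNumericalSolution P 𝓕 β e σ F B τ (schemeIterate β S hb τ u₀) where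
  adapted := stronglyMeasurable_schemeIterate hβ hS hbm hb hu₀
  scheme k := by
    refine ⟨_, isNoiseIncrement_gaussianSeries hβ hbm hb (natCast_mul_add_eq τ k)
      (stronglyMeasurable_schemeIterate hβ hS hbm hb hu₀ k), ae_of_all _ fun ω => ?_⟩
    obtain ⟨z, hz, he⟩ := hSs (schemeIterate β S hb τ u₀ k ω +
      gaussianSeries (fun j u => B u (toU0 sqrtQ (e j))) hb (schemeIterate β S hb τ u₀ k ω,
        fun j => β j ((k + 1 : ℕ) * τ) ω - β j (k * τ) ω))
    refine ⟨z, hz, ?_⟩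
    rw [← sub_sub, sub_eq_iff_eq_add] at he
    exact he

/-- Limits in probability are almost surely unique, so the noise term of any solution is the
Gaussian series; unique solvability of the implicit equation does the rest. -/
theorem StochMaxwell.IsNumericalSolution.ae_eq_schemeStep (hβ : IsBrownianFamily P 𝓕 β)
    (hSu : ∀ u z f, IsMaxwell Θ u z → u - f = (τ : ℝ) • z - (σ * τ) • u + (τ : ℝ) • F u → u = S f)
    (hbm : ∀ j, Measurable fun u => B u (toU0 sqrtQ (e j)))
    (hb : ∀ u, ∑' j, ‖B u (toU0 sqrtQ (e j))‖ₑ ^ 2 ≠ ⊤) {u : ℕ → Ω → EMSpace Θ}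
    (hu : IsNumericalSolution P 𝓕 β e σ F B τ u) (k : ℕ) :
    u (k + 1) =ᵐ[P] fun ω => schemeStep S hb (u k ω,
      fun j => β j ((k + 1 : ℕ) * τ) ω - β j (k * τ) ω) := by
  obtain ⟨Z, hZ, hs⟩ := hu.scheme k
  have h := tendstoInMeasure_ae_unique hZ
    (isNoiseIncrement_gaussianSeries hβ hbm hb (natCast_mul_add_eq τ k) (hu.adapted k))
  filter_upwards [hs, h] with ω ⟨z, hz, he⟩ hω
  refine hSu _ z _ hz ?_
  rw [← sub_sub, sub_eq_iff_eq_add, he, hω]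

theorem StochMaxwell.IsNumericalSolution.ae_eq_of_ae_eq (hβ : IsBrownianFamily P 𝓕 β)
    (hSu : ∀ u z f, IsMaxwell Θ u z → u - f = (τ : ℝ) • z - (σ * τ) • u + (τ : ℝ) • F u → u = S f)
    (hbm : ∀ j, Measurable fun u => B u (toU0 sqrtQ (e j)))
    (hb : ∀ u, ∑' j, ‖B u (toU0 sqrtQ (e j))‖ₑ ^ 2 ≠ ⊤) {u v : ℕ → Ω → EMSpace Θ}
    (hu : IsNumericalSolution P 𝓕 β e σ F B τ u) (hv : IsNumericalSolution P 𝓕 β e σ F B τ v)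
    (h0 : u 0 =ᵐ[P] v 0) (k : ℕ) : u k =ᵐ[P] v k := by
  induction k with
  | zero => exact h0
  | succ k ih =>
    filter_upwards [hu.ae_eq_schemeStep hβ hSu hbm hb k, hv.ae_eq_schemeStep hβ hSu hbm hb k, ih]
      with ω h1 h2 h3
    rw [h1, h2, h3]

theorem isTransitionKernel_randomMapKernel (hβ : IsBrownianFamily P 𝓕 β) (hS : Continuous S)
    (hSu : ∀ u z f, IsMaxwell Θ u z → u - f = (τ : ℝ) • z - (σ * τ) • u + (τ : ℝ) • F u → u = S f)
    (hbm : ∀ j, Measurable fun u => B u (toU0 sqrtQ (e j)))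
    (hb : ∀ u, ∑' j, ‖B u (toU0 sqrtQ (e j))‖ₑ ^ 2 ≠ ⊤) :
    IsTransitionKernel P 𝓕 β e σ F B τ (randomMapKernel (gaussianSeq τ) (schemeStep S hb)) := by
  intro u hu k A hA
  have hle := natCast_mul_le_succ τ k
  have h1 := condExp_indicator_randomMap (𝓕.le (k * τ)) (measurable_schemeStep hS hbm hb)
    (hu.adapted k).measurable ((hβ.measurable_increment hle).mono (𝓕.le _) le_rfl)
    (hβ.indep_past _ _ hle) (hβ.map_increment (natCast_mul_add_eq τ k)) hA
  refine (condExp_congr_ae ?_).trans h1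
  filter_upwards [hu.ae_eq_schemeStep hβ hSu hbm hb k] with ω hω
  exact congrArg (A.indicator fun _ => (1 : ℝ)) hω

end WellPosed

theorem mainTheorem11
    -- the bounded domain
    (Θ : Set R3) (hΘ_open : IsOpen Θ) (hΘ_conn : IsConnected Θ) (hΘ_bdd : Bornology.IsBounded Θ)
    -- the filtered probability space and the driving noise
    {Ω : Type*} {mΩ : MeasurableSpace Ω} (P : Measure Ω) [IsProbabilityMeasure P]
    (𝓕 : Filtration ℝ≥0 mΩ)
    (Q sqrtQ : L2Scalar Θ →L[ℝ] L2Scalar Θ) (hQ : IsCovarianceWithSqrt Q sqrtQ)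
    (e : HilbertBasis ℕ ℝ (L2Scalar Θ))
    (β : ℕ → ℝ≥0 → Ω → ℝ) (hβ : IsBrownianFamily P 𝓕 β)
    -- the coefficients
    (Je Jm Jer Jmr : R3 → R3 → R3 → R3)
    (hJe : IsCaratheodory Θ Je) (hJm : IsCaratheodory Θ Jm)
    (F : EMSpace Θ → EMSpace Θ) (hF : IsDriftNemytskij Θ Je Jm F)
    (B : EMSpace Θ → (U0 sqrtQ →ₗ[ℝ] EMSpace Θ)) (hB : IsDiffusionNemytskij Θ sqrtQ Jer Jmr B)
    (hB_HS : ∀ u : EMSpace Θ, IsHS e (B u))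
    -- one-sided Lipschitz drift, Lipschitz diffusion
    (αF αB : ℝ)
    (hF_mono : ∀ u v : EMSpace Θ, inner ℝ (u - v) (F u - F v) ≤ αF * ‖u - v‖ ^ 2)
    (hB_lip : ∀ u v : EMSpace Θ, hsNorm e (B u - B v) ≤ αB * ‖u - v‖)
    -- strength of the damping
    (σ₀ : ℝ) (hσ₀ : alphaTildeF F αF + 2 * alphaTildeB e B αB ^ 2 < σ₀) :
    ∃ δ : ℝ≥0, 0 < δ ∧ ∀ Δt : ℝ≥0, 0 < Δt → Δt < δ →
      -- the scheme is well posed for square integrable initial data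
      (∀ u₀ : Ω → EMSpace Θ, StronglyMeasurable[𝓕 0] u₀ → MemLp u₀ 2 P →
        (∃ u : ℕ → Ω → EMSpace Θ, IsNumericalSolution P 𝓕 β e σ₀ F B Δt u ∧ u 0 = u₀ ∧
          ∀ k, MemLp (u k) 2 P) ∧
        (∀ u v : ℕ → Ω → EMSpace Θ,
          IsNumericalSolution P 𝓕 β e σ₀ F B Δt u → u 0 =ᵐ[P] u₀ →
          IsNumericalSolution P 𝓕 β e σ₀ F B Δt v → v 0 =ᵐ[P] u₀ →
          ∀ k, u k =ᵐ[P] v k)) ∧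
      -- it is a Markov chain whose transition kernel has exactly one invariant probability measure
      ∃ κ : Kernel (EMSpace Θ) (EMSpace Θ), IsMarkovKernel κ ∧
        IsTransitionKernel P 𝓕 β e σ₀ F B Δt κ ∧
        ∃! π : ProbabilityMeasure (EMSpace Θ), κ.Invariant (π : Measure (EMSpace Θ)) := by
  -- The value `1` is arbitrary: the contraction holds for every positive step size.
  refine ⟨1, one_pos, fun τ hτ _ => ?_⟩
  have hτ' : (0 : ℝ) < τ := hτ
  -- the damping dominates
  have hαB0 : 0 ≤ alphaTildeB e B αB := le_max_of_le_right (Real.sqrt_nonneg _)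
  obtain ⟨α, hα⟩ : ∃ α : ℝ≥0, (α : ℝ) = alphaTildeB e B αB := ⟨⟨_, hαB0⟩, rfl⟩
  -- Only the first entry of the maximum is used, and the extra `1 / 2` is given away in `hdamp`.
  have hαF : 1 / 2 + αF ≤ alphaTildeF F αF := by
    have := le_max_left (1 + 2 * αF) (‖F 0‖ ^ 2)
    rw [alphaTildeF]; linarith
  rw [← hα] at hσ₀
  have hdamp : 2 * (α : ℝ) ^ 2 < σ₀ - αF := by linarith
  obtain ⟨a, ha⟩ : ∃ a : ℝ≥0, (a : ℝ) = σ₀ - αF :=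
    ⟨⟨σ₀ - αF, le_trans (by positivity) hdamp.le⟩, rfl⟩
  have hpos : 0 < 1 + (τ : ℝ) * (σ₀ - αF) := by rw [← ha]; positivity
  have hlip : ∀ u v : EMSpace Θ, hsNorm e (B u - B v) ≤ α * ‖u - v‖ := fun u v =>
    (hB_lip u v).trans (by rw [hα]; gcongr; exact le_max_left _ _)
  -- the solution map of the implicit equation
  choose S z hSz hSe using fun f : EMSpace Θ =>
    exists_isMaxwell_implicit_step hΘ_open hF hJe hJm hF_mono hτ' hpos f
  have hS : LipschitzWith (1 + τ * a)⁻¹ S := by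
    refine LipschitzWith.of_dist_le_mul fun f g => ?_
    have h := mul_norm_sub_le_of_implicit_step hF_mono hτ' (hSz f) (hSe f) (hSz g) (hSe g)
    rw [← ha] at h
    rw [dist_eq_norm, dist_eq_norm, NNReal.coe_inv, le_inv_mul_iff₀ (by positivity)]
    exact_mod_cast h
  have hSu : ∀ u z f, IsMaxwell Θ u z →
      u - f = (τ : ℝ) • z - (σ₀ * τ) • u + (τ : ℝ) • F u → u = S f := by
    intro u z f hz he
    have h := mul_norm_sub_le_of_implicit_step hF_mono hτ' hz he (hSz f) (hSe f)
    rw [sub_self, norm_zero] at h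
    have h2 : ‖u - S f‖ ≤ 0 := nonpos_of_mul_nonpos_right h hpos
    exact sub_eq_zero.1 (norm_le_zero_iff.1 h2)
  have hbm := measurable_apply_of_hsNorm_lipschitz hB_HS hlip
  have hb := tsum_enorm_apply_sq_ne_top hB_HS
  have hG := measurable_schemeStep hS.continuous hbm hb
  have hK := eLpNorm_schemeStep_sub_le hS hB_HS hbm hb hlip τ
  have hK1 := contraction_factor_lt_one hτ (show 2 * (α : ℝ) ^ 2 < a by rw [ha]; exact hdamp)
  have h0 := memLp_schemeStep_zero hS hbm hb τ
  refine ⟨fun u₀ hu₀ hu₀2 => ⟨⟨schemeIterate β S hb τ u₀, ?_, rfl, ?_⟩, ?_⟩, ?_⟩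
  · exact isNumericalSolution_schemeIterate hβ hS.continuous (fun f => ⟨z f, hSz f, hSe f⟩)
      hbm hb hu₀
  · exact memLp_schemeIterate hβ hS.continuous hbm hb hK h0 hu₀ hu₀2
  · exact fun u v hu hu0 hv hv0 => hu.ae_eq_of_ae_eq hβ hSu hbm hb hv (hu0.trans hv0.symm)
  · refine ⟨randomMapKernel (gaussianSeq τ) (schemeStep S hb), isMarkovKernel_randomMapKernel hG,
      isTransitionKernel_randomMapKernel hβ hS.continuous hSu hbm hb, ?_⟩
    obtain ⟨π, hπ⟩ := exists_invariant_randomMapKernel hG hK1 hK h0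
    exact ⟨π, hπ, fun π' hπ' => invariant_randomMapKernel_unique hG hK1 hK hπ' hπ⟩
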